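/- Let $k \ge 1$ and set $t_i = N^{(2^{k-i}-1)/(2^k-1)}$ for $0 \le i \le k$ (so $t_0=N$, $t_k=1$). Let $X, Y$ be finite sets with $|Y| = N\ge 1$ and $|X| = kN$, where $Y$ carries a commutative group operation $+$, and let $F : X \to Y$ be $k$-to-$1$, i.e. $|F^{-1}(y)| = k$ for every $y \in Y$. One quantum query to $F$ is one application of the unitary $|x,y\rangle \mapsto |x, y+F(x)\rangle$. An $i$-collision is a set of $i$ distinct inputs with the same image under $F$. Consider the following quantum algorithm (which depends on $F$ only through queries). 1. Query $F$ classically at $\lceil t_1\rceil$ distinct uniformly random inputs, one after the other; these form the list $L_1$ of $1$-collisions. 2. For $i = 2, \dots, k$, run Grover's algorithm for an unknown number of solutions $\lceil t_i\rceil$ times on the function $F_i$ with $F_i(x)=1$ iff $x$ does not occur in $L_{i-1}$ and $F(x)$ is the image of an $(i-1)$-collision in $L_{i-1}$. Each solution, joined to the $(i-1)$-collision with the same image, gives an $i$-collision; these form $L_i$. Here a run consists of rounds $r=0,1,2,\dots$: draw an integer $j$ uniformly from $0 \le j < \min((6/5)^r, \sqrt{|X|})$, apply $j$ Grover iterations (each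 using two queries to $F$) to the uniform superposition over $X$, make one more query to learn $F$ on the measured input, and stop the run if the measured input is a solution. 3. If two elements of the same list $L_i$ ever have the same image, stop and report failure. Otherwise output the single element of $L_k$. Then $\sum_{i=0}^{k-1} t_{i+1}\sqrt{N/t_i} = k\, N^{(2^{k-1}-1)/(2^k-1)}$, and there is a constant $C > 0$ depending only on $k$ such that for all such $N, X, Y, F$: - the expected number of quantum queries to $F$ made by the algorithm is at most $C\, N^{(2^{k-1}-1)/(2^k-1)}$; - with probability $0$ it outputs something that is not a $k$-collision of $F$; - it outputs a $k$-collision of $F$ with probability at least $1 - C\, N^{-1/2^k}$; - for every real $B>0$, it outputs a $k$-collision of $F$ after at most $B\, N^{(2^{k-1}-1)/(2^k-1)}$ queries with probability at least $1 - C\, N^{-1/2^k} - C/B$. -/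

import Mathlib

open scoped ENNReal

noncomputable section

namespace QuantumCollision

/-! ### Quantum queries -/

/-- Pure (unnormalised) states of a query register `X` and a response register `Y`. -/
abbrev QState (X Y : Type) [Fintype X] [Fintype Y] : Type := EuclideanSpace ℂ (X × Y)

/-- Unitary operators on the two registers. -/
abbrev QGate (X Y : Type) [Fintype X] [Fintype Y] : Type := QState X Y ≃ₗᵢ[ℂ] QState X Y

section Gates

variable {X Y : Type} [Fintype X] [Fintype Y]

/-- One quantum query to `F`: the unitary `|x, y⟩ ↦ |x, y + F x⟩`. -/
def queryGate [AddCommGroup Y] (F : X → Y) : QGate X Y :=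
  LinearIsometryEquiv.piLpCongrLeft 2 ℂ ℂ
    { toFun := fun z => (z.1, z.2 + F z.1)
      invFun := fun z => (z.1, z.2 - F z.1)
      left_inv := fun z => by simp
      right_inv := fun z => by simp }

/-- The unitary `|x, y⟩ ↦ |x, -y⟩`. -/
def negGate [AddCommGroup Y] : QGate X Y :=
  LinearIsometryEquiv.piLpCongrLeft 2 ℂ ℂ ((Equiv.refl X).prodCongr (Equiv.neg Y))

/-- A norm-preserving linear involution, as a unitary. -/
def involutionGate (f : QState X Y →ₗ[ℂ] QState X Y) (hf : ∀ ψ, f (f ψ) = ψ)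
    (hn : ∀ ψ, ‖f ψ‖ = ‖ψ‖) : QGate X Y where
  toLinearEquiv := LinearEquiv.ofInvolutive f hf
  norm_map' := hn

open Classical in
/-- The linear map `|x, y⟩ ↦ -|x, y⟩` if `(x, y) ∈ A`, and `|x, y⟩ ↦ |x, y⟩` otherwise. -/
def phaseMap (A : Set (X × Y)) : QState X Y →ₗ[ℂ] QState X Y where
  toFun ψ := WithLp.toLp 2 fun z => if z ∈ A then -ψ z else ψ z
  map_add' ψ φ := by
    ext z
    by_cases h : z ∈ A <;> simp [h, add_comm]
  map_smul' c ψ := by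
    ext z
    by_cases h : z ∈ A <;> simp [h]

/-- The phase flip of the basis states in `A`. -/
def phaseGate (A : Set (X × Y)) : QGate X Y :=
  involutionGate (phaseMap A)
    (fun ψ => by
      ext z
      by_cases h : z ∈ A <;> simp [phaseMap, h])
    (fun ψ => by
      simp only [EuclideanSpace.norm_eq]
      congr 1
      refine Finset.sum_congr rfl fun z _ => ?_
      by_cases h : z ∈ A <;> simp [phaseMap, h])

/-- The linear map `(2 |s⟩⟨s| - 1) ⊗ 1`, where `|s⟩` is the uniform superposition over `X`:
inversion about the mean in the query register. -/
def diffusionMap : QState X Y →ₗ[ℂ] QState X Y where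
  toFun ψ := WithLp.toLp 2 fun z =>
    2 * ((∑ x : X, ψ (x, z.2)) / (Fintype.card X : ℂ)) - ψ z
  map_add' ψ φ := by
    ext z
    simp [Finset.sum_add_distrib]
    ring
  map_smul' c ψ := by
    ext z
    simp [← Finset.mul_sum]
    ring

lemma diffusionMap_diffusionMap [Nonempty X] (ψ : QState X Y) :
    diffusionMap (diffusionMap ψ) = ψ := by
  have hX : (Fintype.card X : ℂ) ≠ 0 := by exact_mod_cast Fintype.card_ne_zero
  ext z
  simp [diffusionMap, Finset.sum_sub_distrib]
  field_simp
  ring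

lemma norm_diffusionMap [Nonempty X] (ψ : QState X Y) : ‖diffusionMap ψ‖ = ‖ψ‖ := by
  have hX : (Fintype.card X : ℂ) ≠ 0 := by exact_mod_cast Fintype.card_ne_zero
  have h : inner ℂ (diffusionMap ψ) (diffusionMap ψ) = inner ℂ ψ ψ := by
    simp only [PiLp.inner_apply, RCLike.inner_apply, Fintype.sum_prod_type_right]
    refine Finset.sum_congr rfl fun y _ => ?_
    simp only [diffusionMap, LinearMap.coe_mk, AddHom.coe_mk, map_sub, map_mul, map_div₀,
      map_sum, map_natCast, Complex.conj_ofNat]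
    set a : ℂ := ∑ x : X, ψ (x, y) with ha
    set b : ℂ := ∑ x : X, (starRingEnd ℂ) (ψ (x, y)) with hb
    have e : ∀ x : X, (2 * (a / (Fintype.card X : ℂ)) - ψ (x, y)) *
        (2 * (b / (Fintype.card X : ℂ)) - (starRingEnd ℂ) (ψ (x, y))) =
        2 * (a / (Fintype.card X : ℂ)) * (2 * (b / (Fintype.card X : ℂ)))
        - 2 * (a / (Fintype.card X : ℂ)) * (starRingEnd ℂ) (ψ (x, y))
        - 2 * (b / (Fintype.card X : ℂ)) * ψ (x, y)
        + ψ (x, y) * (starRingEnd ℂ) (ψ (x, y)) := fun x => by ring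
    rw [Finset.sum_congr rfl fun x _ => e x]
    simp only [Finset.sum_add_distrib, Finset.sum_sub_distrib, ← Finset.mul_sum, ← ha, ← hb,
      Finset.sum_const, Finset.card_univ, nsmul_eq_mul]
    field_simp
    ring
  rw [inner_self_eq_norm_sq_to_K, inner_self_eq_norm_sq_to_K] at h
  have h' : ‖diffusionMap ψ‖ ^ 2 = ‖ψ‖ ^ 2 := by exact_mod_cast h
  exact (sq_eq_sq₀ (norm_nonneg _) (norm_nonneg _)).1 h'

/-- Grover's diffusion operator on the query register. -/
def diffusionGate [Nonempty X] : QGate X Y :=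
  involutionGate diffusionMap diffusionMap_diffusionMap norm_diffusionMap

end Gates

/-- A quantum query circuit: a unit vector `init` (prepared without queries) and unitaries
`U₁, …, U_q` that do not depend on the queried function. It computes
`U_q O_F U_{q-1} O_F ⋯ U₁ O_F init` and then measures both registers in the computational basis.
(The algorithm below needs no further quantum work register.) -/
structure QCircuit (X Y : Type) [Fintype X] [Fintype Y] where
  init : QState X Y
  norm_init : ‖init‖ = 1
  gates : List (QGate X Y)

namespace QCircuit

variable {X Y : Type} [Fintype X] [Fintype Y]

/-- The number of quantum queries made by the circuit. -/
def queries (c : QCircuit X Y) : ℕ := c.gates.length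

variable [AddCommGroup Y]

/-- The state before the measurement. -/
def final (F : X → Y) (c : QCircuit X Y) : QState X Y :=
  c.gates.foldl (fun ψ U => U (queryGate F ψ)) c.init

lemma norm_foldl (F : X → Y) (l : List (QGate X Y)) (ψ : QState X Y) :
    ‖l.foldl (fun ψ U => U (queryGate F ψ)) ψ‖ = ‖ψ‖ := by
  induction l generalizing ψ with
  | nil => rfl
  | cons U l ih => rw [List.foldl_cons, ih]; simp

lemma norm_final (F : X → Y) (c : QCircuit X Y) : ‖c.final F‖ = 1 :=
  (norm_foldl F c.gates c.init).trans c.norm_init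

/-- The distribution of the measurement outcome (Born rule). -/
def outcome (F : X → Y) (c : QCircuit X Y) : PMF (X × Y) :=
  PMF.ofFintype (fun z => ENNReal.ofReal (‖c.final F z‖ ^ 2)) (by
    rw [← ENNReal.ofReal_sum_of_nonneg (fun z _ => sq_nonneg _), ← EuclideanSpace.norm_sq_eq,
      norm_final]
    simp)

end QCircuit

/-! ### Quantum query algorithms with classical control -/

/-- What an algorithm does next: stop with an output, or draw a circuit at random, run it, and
move to a new classical state that depends on the measurement outcome. -/
inductive QAction (X Y : Type) [Fintype X] [Fintype Y] (S A : Type) : Type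
  | halt (a : A)
  | run (c : PMF (QCircuit X Y)) (next : X × Y → S)

/-- A quantum query algorithm with classical control. It does not depend on the queried
function. -/
structure QAlgorithm (X Y : Type) [Fintype X] [Fintype Y] (A : Type) where
  State : Type
  start : State
  action : State → QAction X Y State A

namespace QAlgorithm

variable {X Y : Type} [Fintype X] [Fintype Y] [AddCommGroup Y] {A : Type}

/-- One step on oracle `F`, from a classical state and a number of queries made so far. -/
def step (𝒜 : QAlgorithm X Y A) (F : X → Y) (s : 𝒜.State × ℕ) : PMF (𝒜.State × ℕ) :=
  match 𝒜.action s.1 with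
  | .halt _ => PMF.pure s
  | .run c next =>
      c.bind fun circ => (circ.outcome F).map fun z => (next z, s.2 + circ.queries)

/-- The distribution of the classical state and of the number of queries after `n` steps. -/
def dist (𝒜 : QAlgorithm X Y A) (F : X → Y) : ℕ → PMF (𝒜.State × ℕ)
  | 0 => PMF.pure (𝒜.start, 0)
  | n + 1 => (𝒜.dist F n).bind (𝒜.step F)

/-- The expected total number of quantum queries on oracle `F` (a limit of an increasing
sequence, possibly infinite). -/
def expectedQueries (𝒜 : QAlgorithm X Y A) (F : X → Y) : ℝ≥0∞ :=
  ⨆ n, ∑' s, 𝒜.dist F n s * (s.2 : ℝ≥0∞)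

/-- The probability that the algorithm halts on oracle `F`, with an output `a` and after a total
of `q` queries such that `P a q` (a limit of an increasing sequence, as an algorithm that has
halted stays as it is). -/
def prob (𝒜 : QAlgorithm X Y A) (F : X → Y) (P : A → ℕ → Prop) : ℝ≥0∞ :=
  ⨆ n, (𝒜.dist F n).toOuterMeasure {s | ∃ a, 𝒜.action s.1 = .halt a ∧ P a s.2}

end QAlgorithm

/-! ### The multi-collision algorithm -/

/-- An `m`-collision of `F`: a set of `m` distinct inputs with the same image. -/
def IsCollision {X Y : Type} (F : X → Y) (m : ℕ) (S : Finset X) : Prop :=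
  S.card = m ∧ ∀ x ∈ S, ∀ x' ∈ S, F x = F x'

/-- The exponent `(2^(k-i) - 1) / (2^k - 1)`, for `i ≤ k`. -/
def exponent (k i : ℕ) : ℝ := ((2 : ℝ) ^ (k - i) - 1) / ((2 : ℝ) ^ k - 1)

/-- The ideal size `t_i = N ^ ((2^(k-i) - 1) / (2^k - 1))` of the list of `i`-collisions. -/
def idealSize (k N i : ℕ) : ℝ := (N : ℝ) ^ exponent k i

/-- The actual size of the list of `i`-collisions: `t_i` rounded up. -/
def listSize (k N i : ℕ) : ℕ := ⌈idealSize k N i⌉₊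

section Algorithm

variable {X Y : Type} [Fintype X] [Fintype Y]

/-- The state `∑ x, |x, 0⟩ / √|X|`. -/
def uniformState [AddCommGroup Y] : QState X Y :=
  open Classical in
  WithLp.toLp 2 fun z => if z.2 = 0 then ((1 / √(Fintype.card X : ℝ) : ℝ) : ℂ) else 0

lemma norm_uniformState [AddCommGroup Y] [Nonempty X] : ‖(uniformState : QState X Y)‖ = 1 := by
  classical
  have hX : (Fintype.card X : ℝ) ≠ 0 := by exact_mod_cast Fintype.card_ne_zero
  rw [EuclideanSpace.norm_eq, Real.sqrt_eq_one, Fintype.sum_prod_type]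
  have h : ∀ x : X, ∑ y : Y, ‖(uniformState : QState X Y) (x, y)‖ ^ 2
      = 1 / (Fintype.card X : ℝ) := fun x => by
    rw [Finset.sum_eq_single (0 : Y)]
    · simp [uniformState]
    · intro y _ hy
      simp [uniformState, hy]
    · simp
  simp [h, hX]

/-- The classical query of `F` at `x`: it prepares `|x, 0⟩`, makes one query and measures
`(x, F x)`. -/
def classicalQuery [AddCommGroup Y] (x : X) : QCircuit X Y where
  init := open Classical in EuclideanSpace.single (x, 0) 1
  norm_init := by simp
  gates := [LinearIsometryEquiv.refl ℂ (QState X Y)]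

/-- The unitaries of one Grover iteration for the set `A` of accepted input-output pairs. With
the queries in between, on states `|x, 0⟩`: query `F`, flip the phase if `(x, F x) ∈ A`, uncompute
`F x` by a second query between two negations, and apply the diffusion operator. -/
def groverGates [AddCommGroup Y] [Nonempty X] (A : Set (X × Y)) : List (QGate X Y) :=
  [(phaseGate A).trans negGate, negGate.trans diffusionGate]

/-- `j` Grover iterations from the uniform superposition, and one more query, such that the
measurement gives an input together with its image. -/
def groverCircuit [AddCommGroup Y] [Nonempty X] (A : Set (X × Y)) (j : ℕ) : QCircuit X Y where
  init := uniformState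
  norm_init := norm_uniformState
  gates := (List.replicate j (groverGates A)).flatten ++ [LinearIsometryEquiv.refl ℂ (QState X Y)]

/-- The bound `min ((6/5)^r) √|X|` of round `r` in Grover's algorithm for an unknown number of
solutions. -/
def roundBound (X : Type) [Fintype X] (r : ℕ) : ℝ :=
  min ((6 / 5 : ℝ) ^ r) √(Fintype.card X : ℝ)

lemma range_roundBound_nonempty [Nonempty X] (r : ℕ) :
    (Finset.range ⌈roundBound X r⌉₊).Nonempty := by
  rw [Finset.nonempty_range_iff, ← Nat.pos_iff_ne_zero, Nat.ceil_pos]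
  have : 0 < (Fintype.card X : ℝ) := by exact_mod_cast Fintype.card_pos
  exact lt_min (by positivity) (by positivity)

/-- Round `r` of Grover's algorithm for an unknown number of solutions: the number of iterations
is a uniformly random non-negative integer `j < min ((6/5)^r) √|X|`. -/
def groverRound [AddCommGroup Y] [Nonempty X] (A : Set (X × Y)) (r : ℕ) : PMF (QCircuit X Y) :=
  (PMF.uniformOfFinset (Finset.range ⌈roundBound X r⌉₊) (range_roundBound_nonempty r)).map
    (groverCircuit A)

/-- A list of collisions, each with its image. -/
abbrev CollisionList (X Y : Type) : Type := List (Finset X × Y)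

/-- The pairs `(x, y)` such that `x` does not occur in `L` and `y` is an image of `L`. Searching
for `x` with `(x, F x)` in this set is searching for an input that extends a collision of `L`. -/
def extending (L : CollisionList X Y) : Set (X × Y) :=
  {z | (∀ e ∈ L, z.1 ∉ e.1) ∧ ∃ e ∈ L, e.2 = z.2}

/-- Classical states of the algorithm. In `collect i L M r`, the complete list of
`(i-1)`-collisions is `L` (empty for `i = 1`), the incomplete list of `i`-collisions is `M`, and
the current run of Grover's algorithm has had `r` unsuccessful rounds. -/
inductive CollisionState (X Y : Type) : Type
  | collect (i : ℕ) (L M : CollisionList X Y) (r : ℕ)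
  | done (result : Option (Finset X))

open Classical in
/-- A new `i`-collision `e` has been found. The algorithm fails if it collides with one in `M`.
Otherwise `e` is put on the list. If that completes the list, the algorithm goes on to
`(i+1)`-collisions, or outputs `e` if `i = k`. -/
def addCollision (k i : ℕ) (L M : CollisionList X Y) (e : Finset X × Y) : CollisionState X Y :=
  if ∃ e' ∈ M, e'.2 = e.2 then .done none
  else if M.length + 1 < listSize k (Fintype.card Y) i then .collect i L (e :: M) 0
  else if i < k then .collect (i + 1) (e :: M) [] 0
  else .done (some e.1)

open Classical in
/-- The inputs that do not occur in `M`. -/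
def freshInputs (M : CollisionList X Y) : Finset X :=
  Finset.univ.filter fun x => ∀ e ∈ M, x ∉ e.1

open Classical in
/-- The `i`-collision obtained from `x` and the collision of `L` with image `y`. -/
def extend (L : CollisionList X Y) (z : X × Y) : Finset X × Y :=
  match L.find? (fun e => e.2 = z.2) with
  | some e => (insert z.1 e.1, z.2)
  | none => ({z.1}, z.2)

open Classical in
/-- The recursive algorithm for `k`-collisions. The list of `1`-collisions comes from classical
queries at distinct random points. For `2 ≤ i ≤ k`, each of the `t_i` `i`-collisions comes from a
run of Grover's algorithm for an input that extends an `(i-1)`-collision on the previous list: its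
rounds are repeated until the measured input is a solution. -/
def collisionAlgorithm (X Y : Type) [Fintype X] [Fintype Y] [AddCommGroup Y] [Nonempty X]
    (k : ℕ) : QAlgorithm X Y (Option (Finset X)) where
  State := CollisionState X Y
  start := .collect 1 [] [] 0
  action
    | .done result => .halt result
    | .collect i L M r =>
        if i ≤ 1 then
          if h : (freshInputs M).Nonempty then
            .run ((PMF.uniformOfFinset (freshInputs M) h).map classicalQuery)
              fun z => addCollision k i L M ({z.1}, z.2)
          else .halt none
        else
          .run (groverRound (extending L) r) fun z =>
            if z ∈ extending L then addCollision k i L M (extend L z)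
            else .collect i L M (r + 1)

end Algorithm

end QuantumCollision

end

noncomputable section

namespace QuantumCollision

/-! ### Expectations of extended non-negative random variables -/

/-! The algorithm is treated as a Markov chain on pairs (classical state, queries so far), and both
quantitative bounds come from one supermartingale argument. `potential` assigns to each state the
expected cost still to come: a weight `u i r` for the current search, `u j 0` for every later
`j`-collision, and `a` for failure. `expect_step_collect_one` and `expect_step_collect` show that `κ
* queries + potential` does not increase in expectation, so by `expect_dist_potential_le` it stays
below its initial value, the sum of `listSize i * u i 0`. The choice `κ = 1`, `a = 0` bounds the
expected queries, and `κ = 0`, `a = 1` bounds the probability of failure.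

The weights come from Grover search. An iteration rotates by `2θ` in the plane spanned by the
solutions and the non-solutions, where `sin² θ = T / |X|`. Averaging over a random number of
iterations gives success probability at least `1/4` once `(6/5)^r ≥ √(|X| / T)` (`le_sum_sin_sq`,
`exists_expect_groverRound`). From then on the cost of a round grows by `6/5` while a failure has
probability at most `3/4`; since `6/5 * 3/4 < 1`, a run costs `O(√(|X| / T))` queries
(`groverPotential_step`).

All solutions are equally likely to be measured, and each image of the list of `(i-1)`-collisions
has the same number `k - (i-1)` of them. A successful run therefore hits an image already used with
probability `|M| / |L|`, at most about `t_i / t_{i-1}`. The exponents make `t_{i+1} √(N / t_i)` and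
`t_{i+1}² / t_i` independent of `i`, so every level costs `O(t_1)` queries and contributes
`O(N^(-1/(2^k-1)))` to failure.

The potential is `⊤` on states that violate the invariant and on wrong outputs. Its expectation is
finite, so such states have probability zero. Markov's inequality converts the expected number of
queries into the bound for a fixed budget, and also into almost sure termination, because every step
that does not halt makes a query. -/

/-- The expectation of `f` under `p`. -/
def expect {α : Type*} (p : PMF α) (f : α → ℝ≥0∞) : ℝ≥0∞ := ∑' a, p a * f a

section Expect

variable {α β : Type*}

lemma expect_const (p : PMF α) (c : ℝ≥0∞) : expect p (fun _ => c) = c := by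
  rw [expect, ENNReal.tsum_mul_right, p.tsum_coe, one_mul]

lemma expect_add (p : PMF α) (f g : α → ℝ≥0∞) :
    expect p (fun a => f a + g a) = expect p f + expect p g := by
  simp only [expect, mul_add, ENNReal.tsum_add]

lemma expect_mul_const (p : PMF α) (f : α → ℝ≥0∞) (c : ℝ≥0∞) :
    expect p (fun a => f a * c) = expect p f * c := by
  simp only [expect, ← mul_assoc, ENNReal.tsum_mul_right]

lemma expect_mono (p : PMF α) {f g : α → ℝ≥0∞} (h : ∀ a ∈ p.support, f a ≤ g a) :
    expect p f ≤ expect p g := by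
  refine ENNReal.tsum_le_tsum fun a => ?_
  by_cases ha : a ∈ p.support
  · gcongr
    exact h a ha
  · simp [(PMF.apply_eq_zero_iff p a).2 ha]

/-- An outcome of positive mass with infinite value would make the sum infinite. This extracts
almost sure invariants from a bound on an expectation. -/
lemma ne_top_of_expect_ne_top (p : PMF α) {f : α → ℝ≥0∞} (h : expect p f ≠ ⊤) {a : α}
    (ha : a ∈ p.support) : f a ≠ ⊤ := by
  intro hf
  refine ENNReal.ne_top_of_tsum_ne_top h a ?_
  rw [hf, ENNReal.mul_top ((PMF.mem_support_iff _ _).1 ha)]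

lemma expect_pure (a : α) (f : α → ℝ≥0∞) : expect (PMF.pure a) f = f a := by
  rw [expect, tsum_eq_single a]
  · simp
  · intro b hb
    simp [PMF.pure_apply, hb]

lemma expect_bind (p : PMF α) (q : α → PMF β) (f : β → ℝ≥0∞) :
    expect (p.bind q) f = expect p fun a => expect (q a) f := by
  simp only [expect, PMF.bind_apply, ← ENNReal.tsum_mul_right, ← ENNReal.tsum_mul_left]
  rw [ENNReal.tsum_comm]
  simp only [mul_assoc]

lemma expect_map (p : PMF α) (g : α → β) (f : β → ℝ≥0∞) :
    expect (p.map g) f = expect p fun a => f (g a) := by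
  simp only [PMF.map, expect_bind, Function.comp, expect_pure]

lemma expect_uniformOfFinset (s : Finset α) (hs : s.Nonempty) (f : α → ℝ≥0∞) :
    expect (PMF.uniformOfFinset s hs) f = (s.card : ℝ≥0∞)⁻¹ * ∑ a ∈ s, f a := by
  classical
  rw [expect, tsum_eq_sum (s := s), Finset.mul_sum]
  · refine Finset.sum_congr rfl fun a ha => ?_
    rw [PMF.uniformOfFinset_apply_of_mem hs ha]
  · intro a ha
    rw [PMF.uniformOfFinset_apply_of_notMem hs ha, zero_mul]

lemma expect_indicator (p : PMF α) (s : Set α) :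
    expect p (s.indicator fun _ => 1) = p.toOuterMeasure s := by
  rw [PMF.toOuterMeasure_apply, expect]
  refine tsum_congr fun a => ?_
  by_cases h : a ∈ s <;> simp [h]

end Expect

/-! ### Runs of a query algorithm as a Markov chain -/

namespace QAlgorithm

variable {X Y : Type} [Fintype X] [Fintype Y] [AddCommGroup Y] {A : Type}

lemma step_of_halt (𝒜 : QAlgorithm X Y A) (F : X → Y) {s : 𝒜.State × ℕ} {a : A}
    (h : 𝒜.action s.1 = .halt a) : 𝒜.step F s = PMF.pure s := by
  simp only [step, h]

lemma expect_step_of_run (𝒜 : QAlgorithm X Y A) (F : X → Y) {s : 𝒜.State × ℕ}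
    {c : PMF (QCircuit X Y)} {next : X × Y → 𝒜.State} (h : 𝒜.action s.1 = .run c next)
    (Φ : 𝒜.State × ℕ → ℝ≥0∞) :
    expect (𝒜.step F s) Φ = expect c fun circ =>
      expect (circ.outcome F) fun z => Φ (next z, s.2 + circ.queries) := by
  simp only [step, h, expect_bind, expect_map]

/-- The expectation of a superharmonic function does not increase along a run. -/
lemma expect_dist_le (𝒜 : QAlgorithm X Y A) (F : X → Y) (Φ : 𝒜.State × ℕ → ℝ≥0∞)
    (h : ∀ s, expect (𝒜.step F s) Φ ≤ Φ s) (n : ℕ) :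
    expect (𝒜.dist F n) Φ ≤ Φ (𝒜.start, 0) := by
  induction n with
  | zero => simp only [dist, expect_pure, le_refl]
  | succ n ih =>
    rw [dist, expect_bind]
    exact (expect_mono _ fun s _ => h s).trans ih

/-- If every circuit makes at least one query, then an algorithm that has not halted after `n`
steps has made at least `n` queries. -/
lemma halted_or_le_queries (𝒜 : QAlgorithm X Y A) (F : X → Y)
    (h : ∀ s c next, 𝒜.action s = .run c next → ∀ circ ∈ c.support, 1 ≤ circ.queries) (n : ℕ) :
    ∀ s ∈ (𝒜.dist F n).support, (∃ a, 𝒜.action s.1 = .halt a) ∨ n ≤ s.2 := by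
  induction n with
  | zero => simp
  | succ n ih =>
    intro s hs
    rw [dist, PMF.mem_support_bind_iff] at hs
    obtain ⟨s', hs', hs⟩ := hs
    cases hact : 𝒜.action s'.1 with
    | halt a =>
      rw [𝒜.step_of_halt F hact, PMF.mem_support_pure_iff] at hs
      exact .inl ⟨a, hs ▸ hact⟩
    | run c next =>
      right
      simp only [step, hact] at hs
      rw [PMF.mem_support_bind_iff] at hs
      obtain ⟨circ, hc, hs⟩ := hs
      rw [PMF.mem_support_map_iff] at hs
      obtain ⟨z, -, rfl⟩ := hs
      have h1 := h _ _ _ hact circ hc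
      rcases ih s' hs' with ⟨a, ha⟩ | hle
      · simp [hact] at ha
      · simp only
        omega

end QAlgorithm

/-! ### Grover's algorithm -/

section Gates

variable {X Y : Type} [Fintype X] [Fintype Y]

open Classical in
lemma phaseGate_apply (A : Set (X × Y)) (ψ : QState X Y) (z : X × Y) :
    phaseGate A ψ z = if z ∈ A then -ψ z else ψ z := rfl

lemma diffusionGate_apply [Nonempty X] (ψ : QState X Y) (z : X × Y) :
    diffusionGate ψ z = 2 * ((∑ x : X, ψ (x, z.2)) / (Fintype.card X : ℂ)) - ψ z := rfl

variable [AddCommGroup Y]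

lemma queryGate_apply (F : X → Y) (ψ : QState X Y) (z : X × Y) :
    queryGate F ψ z = ψ (z.1, z.2 - F z.1) := rfl

lemma negGate_apply (ψ : QState X Y) (z : X × Y) : negGate ψ z = ψ (z.1, -z.2) := rfl

open Classical in
/-- The state with amplitude `g x` at `|x, 0⟩`. -/
def queryState (g : X → ℂ) : QState X Y :=
  WithLp.toLp 2 fun z => if z.2 = 0 then g z.1 else 0

open Classical in
lemma queryState_apply (g : X → ℂ) (z : X × Y) :
    (queryState g : QState X Y) z = if z.2 = 0 then g z.1 else 0 := rfl

open Classical in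
/-- The effect of one Grover iteration on a state of the query register. -/
lemma foldl_groverGates [Nonempty X] (F : X → Y) (A : Set (X × Y)) (g : X → ℂ) :
    (groverGates A).foldl (fun ψ U => U (queryGate F ψ)) (queryState g) =
      queryState fun x =>
        2 * ((∑ x', if (x', F x') ∈ A then -g x' else g x') / (Fintype.card X : ℂ)) -
          if (x, F x) ∈ A then -g x else g x := by
  ext z
  obtain ⟨x, y⟩ := z
  -- A query between two negations acts as `y ↦ y - F x`, so it undoes the first query and leaves
  -- only the phase.
  have key : ∀ x : X, negGate (queryGate F (negGate (phaseGate A (queryGate F (queryState g)))))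
      (x, y) = if y = 0 then (if (x, F x) ∈ A then -g x else g x) else 0 := by
    intro x
    simp only [negGate_apply, queryGate_apply, phaseGate_apply, queryState_apply]
    by_cases hy : y = 0
    · simp [hy]
    · simp [hy]
  simp only [groverGates, List.foldl_cons, List.foldl_nil, LinearIsometryEquiv.trans_apply,
    diffusionGate_apply, key, queryState_apply]
  by_cases hy : y = 0 <;> simp [hy]

open Classical in
/-- The amplitudes after some Grover iterations: `a` on the solutions and `b` elsewhere. -/
lemma foldl_replicate_groverGates [Nonempty X] (F : X → Y) (A : Set (X × Y)) (θ : ℝ) (T : ℕ)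
    (hT : (Finset.univ.filter fun x => (x, F x) ∈ A).card = T) (hT0 : 0 < T)
    (hTK : T < Fintype.card X) (hs : Real.sin θ = √(T : ℝ) / √(Fintype.card X : ℝ))
    (hc : Real.cos θ = √((Fintype.card X : ℝ) - T) / √(Fintype.card X : ℝ)) (j : ℕ) :
    ((List.replicate j (groverGates A)).flatten).foldl (fun ψ U => U (queryGate F ψ))
      (uniformState : QState X Y) =
      queryState fun x => if (x, F x) ∈ A then ((Real.sin ((2 * j + 1) * θ) / √(T : ℝ) : ℝ) : ℂ)
        else ((Real.cos ((2 * j + 1) * θ) / √((Fintype.card X : ℝ) - T) : ℝ) : ℂ) := by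
  set K := Fintype.card X with hK
  have hT' : (0 : ℝ) < T := by exact_mod_cast hT0
  have hK' : (0 : ℝ) < (K : ℝ) - T := by rw [sub_pos]; exact_mod_cast hTK
  have hK0 : (0 : ℝ) < K := by linarith
  have h1 := Real.sqrt_pos.2 hT'
  have h2 := Real.sqrt_pos.2 hK'
  have h3 := Real.sqrt_pos.2 hK0
  have e1 := Real.mul_self_sqrt hT'.le
  have e2 := Real.mul_self_sqrt hK'.le
  have e3 := Real.mul_self_sqrt hK0.le
  induction j with
  | zero =>
    ext z
    simp only [List.replicate_zero, List.flatten_nil, List.foldl_nil, queryState_apply,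
      uniformState, Nat.cast_zero, mul_zero, zero_add, one_mul, hs, hc]
    rw [div_div_cancel_left' h1.ne', div_div_cancel_left' h2.ne', one_div]
    simp [hK]
  | succ j ih =>
    rw [List.replicate_succ', List.flatten_append, List.flatten_singleton, List.foldl_append, ih,
      foldl_groverGates]
    congr 1
    set φ : ℝ := (2 * j + 1) * θ with hφ
    have hφ' : (2 * ((j + 1 : ℕ) : ℝ) + 1) * θ = φ + 2 * θ := by
      rw [hφ]; push_cast; ring
    -- After the phase flip the amplitudes sum to `-√T sin φ + √(K - T) cos φ`, which is `√K cos (φ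
    -- + θ)` by the addition formula.
    have hsum : (∑ x', if (x', F x') ∈ A then -(if (x', F x') ∈ A then
        ((Real.sin φ / √(T : ℝ) : ℝ) : ℂ) else ((Real.cos φ / √((K : ℝ) - T) : ℝ) : ℂ)) else
        (if (x', F x') ∈ A then
        ((Real.sin φ / √(T : ℝ) : ℝ) : ℂ) else ((Real.cos φ / √((K : ℝ) - T) : ℝ) : ℂ)))
        = ((√(K : ℝ) * Real.cos (φ + θ) : ℝ) : ℂ) := by
      have : ∀ x', (if (x', F x') ∈ A then -(if (x', F x') ∈ A then
        ((Real.sin φ / √(T : ℝ) : ℝ) : ℂ) else ((Real.cos φ / √((K : ℝ) - T) : ℝ) : ℂ)) else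
        (if (x', F x') ∈ A then
        ((Real.sin φ / √(T : ℝ) : ℝ) : ℂ) else ((Real.cos φ / √((K : ℝ) - T) : ℝ) : ℂ))) =
        (if (x', F x') ∈ A then -((Real.sin φ / √(T : ℝ) : ℝ) : ℂ) else
          ((Real.cos φ / √((K : ℝ) - T) : ℝ) : ℂ)) := fun x' => by split_ifs <;> rfl
      rw [Finset.sum_congr rfl fun x' _ => this x', Finset.sum_ite, Finset.sum_const,
        Finset.sum_const, hT]
      have hcard : ((Finset.univ.filter fun x => ¬ (x, F x) ∈ A).card : ℝ) = K - T := by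
        rw [← Finset.compl_filter, Finset.card_compl, hT, Nat.cast_sub hTK.le]
      rw [nsmul_eq_mul, nsmul_eq_mul]
      have hre : (T : ℝ) * -(Real.sin φ / √(T : ℝ)) +
          ((Finset.univ.filter fun x => ¬ (x, F x) ∈ A).card : ℝ) *
            (Real.cos φ / √((K : ℝ) - T)) = √(K : ℝ) * Real.cos (φ + θ) := by
        rw [hcard, Real.cos_add, hs, hc]
        have a1 : (T : ℝ) * -(Real.sin φ / √(T : ℝ)) = - (√(T : ℝ) * Real.sin φ) := by
          field_simp
          linear_combination Real.sin φ * e1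
        have a2 : ((K : ℝ) - T) * (Real.cos φ / √((K : ℝ) - T)) =
            √((K : ℝ) - T) * Real.cos φ := by
          field_simp
          linear_combination -Real.cos φ * e2
        rw [a1, a2]
        field_simp
        ring
      exact_mod_cast congrArg (fun t : ℝ => (t : ℂ)) hre
    rw [hsum, hφ']
    -- Inversion about the mean becomes the sum-to-product identities for angles `φ` and `φ + 2θ`,
    -- with midpoint `φ + θ`.
    have i1 : 2 * (√(K : ℝ) * Real.cos (φ + θ) / K) + Real.sin φ / √(T : ℝ) =
        Real.sin (φ + 2 * θ) / √(T : ℝ) := by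
      have : Real.sin (φ + 2 * θ) = 2 * Real.sin θ * Real.cos (φ + θ) + Real.sin φ := by
        have := Real.sin_sub_sin (φ + 2 * θ) φ
        rw [show (φ + 2 * θ - φ) / 2 = θ by ring, show (φ + 2 * θ + φ) / 2 = φ + θ by ring] at this
        linarith
      rw [this, hs]
      have : √(K : ℝ) * Real.cos (φ + θ) / K = Real.cos (φ + θ) / √(K : ℝ) := by
        rw [div_eq_div_iff hK0.ne' h3.ne']; linear_combination Real.cos (φ + θ) * e3
      rw [this]
      field_simp
    have i2 : 2 * (√(K : ℝ) * Real.cos (φ + θ) / K) - Real.cos φ / √((K : ℝ) - T) =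
        Real.cos (φ + 2 * θ) / √((K : ℝ) - T) := by
      have : Real.cos (φ + 2 * θ) = 2 * Real.cos θ * Real.cos (φ + θ) - Real.cos φ := by
        have := Real.cos_add_cos (φ + 2 * θ) φ
        rw [show (φ + 2 * θ - φ) / 2 = θ by ring, show (φ + 2 * θ + φ) / 2 = φ + θ by ring] at this
        linarith
      rw [this, hc]
      have : √(K : ℝ) * Real.cos (φ + θ) / K = Real.cos (φ + θ) / √(K : ℝ) := by
        rw [div_eq_div_iff hK0.ne' h3.ne']; linear_combination Real.cos (φ + θ) * e3
      rw [this]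
      field_simp
    funext x
    split_ifs with hx
    · rw [← i1]; push_cast; ring
    · rw [← i2]; push_cast; ring

open Classical in
/-- The distribution of the measured input and its image. -/
lemma outcome_groverCircuit [Nonempty X] (F : X → Y) (A : Set (X × Y)) (θ : ℝ) (T : ℕ)
    (hT : (Finset.univ.filter fun x => (x, F x) ∈ A).card = T) (hT0 : 0 < T)
    (hTK : T < Fintype.card X) (hs : Real.sin θ = √(T : ℝ) / √(Fintype.card X : ℝ))
    (hc : Real.cos θ = √((Fintype.card X : ℝ) - T) / √(Fintype.card X : ℝ)) (j : ℕ)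
    (z : X × Y) :
    (groverCircuit A j).outcome F z = if z.2 = F z.1 then ENNReal.ofReal (
      if (z.1, F z.1) ∈ A then Real.sin ((2 * j + 1) * θ) ^ 2 / T
        else Real.cos ((2 * j + 1) * θ) ^ 2 / ((Fintype.card X : ℝ) - T)) else 0 := by
  have hK' : (0 : ℝ) ≤ (Fintype.card X : ℝ) - T := by rw [sub_nonneg]; exact_mod_cast hTK.le
  rw [QCircuit.outcome, PMF.ofFintype_apply, QCircuit.final, groverCircuit]
  simp only [List.foldl_append, List.foldl_cons, List.foldl_nil,
    foldl_replicate_groverGates F A θ T hT hT0 hTK hs hc j, LinearIsometryEquiv.coe_refl, id,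
    queryGate_apply, queryState_apply, sub_eq_zero]
  split_ifs with h1 h2
  · rw [Complex.norm_real, Real.norm_eq_abs, sq_abs, div_pow, Real.sq_sqrt (Nat.cast_nonneg T)]
  · rw [Complex.norm_real, Real.norm_eq_abs, sq_abs, div_pow, Real.sq_sqrt hK']
  · simp

open Classical in
lemma outcome_classicalQuery (F : X → Y) (x : X) (z : X × Y) :
    (classicalQuery x : QCircuit X Y).outcome F z = if z = (x, F x) then 1 else 0 := by
  rw [QCircuit.outcome, PMF.ofFintype_apply, QCircuit.final, classicalQuery]
  simp only [List.foldl_cons, List.foldl_nil, LinearIsometryEquiv.coe_refl, id, queryGate_apply]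
  obtain ⟨x', y⟩ := z
  by_cases hx : x' = x
  · subst hx
    by_cases hy : y = F x' <;> simp [hy, sub_eq_zero]
  · simp [hx]

lemma expect_classicalQuery (F : X → Y) (x : X) (h : X × Y → ℝ≥0∞) :
    expect ((classicalQuery x : QCircuit X Y).outcome F) h = h (x, F x) := by
  classical
  rw [expect, tsum_eq_single (x, F x)]
  · simp [outcome_classicalQuery]
  · intro z hz
    simp [outcome_classicalQuery, hz]

end Gates


/-! ### The success probability of a round -/

/-- With `sin² φ = (1 - cos 2φ) / 2`, multiplication by `sin 2θ` turns the cosines into differences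
of sines that telescope. -/
lemma four_mul_sin_mul_sum_sin_sq (θ : ℝ) (m : ℕ) :
    4 * Real.sin (2 * θ) * ∑ j ∈ Finset.range m, Real.sin ((2 * j + 1) * θ) ^ 2 =
      2 * m * Real.sin (2 * θ) - Real.sin (4 * m * θ) := by
  induction m with
  | zero => simp
  | succ m ih =>
    rw [Finset.sum_range_succ, mul_add, ih]
    set φ : ℝ := (2 * m + 1) * θ with hφ
    have h := Real.sin_sub_sin (4 * ((m + 1 : ℕ) : ℝ) * θ) (4 * m * θ)
    rw [show (4 * ((m + 1 : ℕ) : ℝ) * θ - 4 * m * θ) / 2 = 2 * θ by push_cast; ring,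
      show (4 * ((m + 1 : ℕ) : ℝ) * θ + 4 * m * θ) / 2 = 2 * φ by push_cast; ring,
      Real.cos_two_mul, Real.cos_sq'] at h
    push_cast at h ⊢
    linear_combination h

/-- For `θ ≤ π/3`, `cos θ ≥ 1/2` makes the right side at least `m sin θ ≥ 1`. For larger `θ`,
reflect to `φ = π/2 - θ`, which changes the sign on the left: either `4mφ ≤ π` and the left side is
nonpositive, or Jordan's inequality gives `m sin 2φ ≥ 4mφ/π > 1`. The second case removes the usual
assumption that solutions are not too dense. -/
lemma sin_four_mul_le {θ : ℝ} (h0 : 0 < θ) (h1 : θ < Real.pi / 2) {m : ℕ}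
    (hm : 1 ≤ m * Real.sin θ) : Real.sin (4 * m * θ) ≤ m * Real.sin (2 * θ) := by
  have hpi := Real.pi_pos
  rcases le_or_gt θ (Real.pi / 3) with h | h
  · have hc : 1 / 2 ≤ Real.cos θ := by
      rw [← Real.cos_pi_div_three]
      exact Real.cos_le_cos_of_nonneg_of_le_pi h0.le (by linarith) h
    rw [Real.sin_two_mul]
    refine (Real.sin_le_one _).trans ?_
    nlinarith
  · set φ := Real.pi / 2 - θ with hφ
    have e1 : Real.sin (4 * m * θ) = -Real.sin (4 * m * φ) := by
      rw [show 4 * m * θ = m * (2 * Real.pi) - 4 * m * φ by rw [hφ]; ring,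
        Real.sin_nat_mul_two_pi_sub]
    have e2 : Real.sin (2 * θ) = Real.sin (2 * φ) := by
      rw [show 2 * φ = Real.pi - 2 * θ by rw [hφ]; ring, Real.sin_pi_sub]
    have h2 := Real.mul_le_sin (x := 2 * φ) (by linarith) (by linarith)
    have hm0 : (0 : ℝ) ≤ m := Nat.cast_nonneg m
    have hφ0 : 0 < φ := by linarith
    rw [e1, e2]
    rcases le_or_gt (4 * m * φ) Real.pi with h3 | h3
    · have a := Real.sin_nonneg_of_nonneg_of_le_pi (by positivity) h3
      have b : 0 ≤ m * Real.sin (2 * φ) :=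
        mul_nonneg hm0 (Real.sin_nonneg_of_nonneg_of_le_pi (by linarith) (by linarith))
      linarith
    · have a := Real.neg_one_le_sin (4 * m * φ)
      have b : 1 ≤ m * (2 / Real.pi * (2 * φ)) := by
        rw [show m * (2 / Real.pi * (2 * φ)) = 4 * m * φ / Real.pi by ring, le_div_iff₀ hpi]
        linarith
      have c := mul_le_mul_of_nonneg_left h2 hm0
      linarith

/-- If the number of iterations is uniformly random among enough values, then a solution is found
with probability at least `1/4`. -/
lemma le_sum_sin_sq {θ : ℝ} (h0 : 0 < θ) (h1 : θ < Real.pi / 2) {m : ℕ}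
    (hm : 1 ≤ m * Real.sin θ) :
    (m : ℝ) / 4 ≤ ∑ j ∈ Finset.range m, Real.sin ((2 * j + 1) * θ) ^ 2 := by
  have hs : 0 < Real.sin (2 * θ) := Real.sin_pos_of_pos_of_lt_pi (by linarith) (by linarith)
  have h2 := four_mul_sin_mul_sum_sin_sq θ m
  -- Hence `4 sin 2θ` times the sum is at least `m sin 2θ`, and `sin 2θ > 0` can be cancelled.
  have h3 := sin_four_mul_le h0 h1 hm
  by_contra! h
  nlinarith

section Round

variable {X Y : Type} [Fintype X] [Fintype Y] [AddCommGroup Y] [Nonempty X]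

lemma one_le_roundBound (r : ℕ) : 1 ≤ roundBound X r := by
  refine le_min (one_le_pow₀ (by norm_num)) ?_
  rw [Real.one_le_sqrt]
  exact_mod_cast Fintype.card_pos (α := X)

lemma queries_groverCircuit (A : Set (X × Y)) (j : ℕ) : (groverCircuit A j).queries = 2 * j + 1 := by
  simp [QCircuit.queries, groverCircuit, groverGates, mul_comm]

lemma one_le_queries_of_mem_groverRound (A : Set (X × Y)) (r : ℕ) :
    ∀ c ∈ (groverRound A r).support, 1 ≤ c.queries := by
  intro c hc
  rw [groverRound, PMF.mem_support_map_iff] at hc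
  obtain ⟨j, -, rfl⟩ := hc
  rw [queries_groverCircuit]
  omega

/-- The first `m` odd numbers add up to `m²`, so their average is `m`. -/
lemma expect_groverRound_queries (A : Set (X × Y)) (r : ℕ) :
    expect (groverRound A r) (fun c => (c.queries : ℝ≥0∞)) = (⌈roundBound X r⌉₊ : ℝ≥0∞) := by
  set m := ⌈roundBound X r⌉₊ with hm
  have hm0 : m ≠ 0 := (Nat.ceil_pos.2 (by linarith [one_le_roundBound (X := X) r])).ne'
  have hsum : ∑ j ∈ Finset.range m, (2 * j + 1) = m * m := by
    clear_value m
    clear hm hm0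
    induction m with
    | zero => simp
    | succ m ih => rw [Finset.sum_range_succ, ih]; ring
  rw [groverRound, expect_map, expect_uniformOfFinset]
  simp only [queries_groverCircuit, Finset.card_range]
  rw [← Nat.cast_sum, ← hm, hsum, Nat.cast_mul, ← mul_assoc,
    ENNReal.inv_mul_cancel (by exact_mod_cast hm0) (ENNReal.natCast_ne_top m), one_mul]

lemma ceil_roundBound_le (r : ℕ) : (⌈roundBound X r⌉₊ : ℝ) ≤ 2 * (6 / 5 : ℝ) ^ r := by
  have h1 := one_le_roundBound (X := X) r
  have h2 := (Nat.ceil_lt_add_one (zero_le_one.trans h1)).le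
  have h3 : roundBound X r ≤ (6 / 5 : ℝ) ^ r := min_le_left _ _
  linarith

open Classical in
lemma expect_groverCircuit (F : X → Y) (A : Set (X × Y)) (θ : ℝ) (T : ℕ)
    (hT : (Finset.univ.filter fun x => (x, F x) ∈ A).card = T) (hT0 : 0 < T)
    (hTK : T < Fintype.card X) (hs : Real.sin θ = √(T : ℝ) / √(Fintype.card X : ℝ))
    (hc : Real.cos θ = √((Fintype.card X : ℝ) - T) / √(Fintype.card X : ℝ)) (j : ℕ)
    (h : X × Y → ℝ≥0∞) :
    expect ((groverCircuit A j).outcome F) h =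
      ENNReal.ofReal (Real.sin ((2 * j + 1) * θ) ^ 2 / T) * ∑ x with (x, F x) ∈ A, h (x, F x) +
      ENNReal.ofReal (Real.cos ((2 * j + 1) * θ) ^ 2 / ((Fintype.card X : ℝ) - T)) *
        ∑ x with (x, F x) ∉ A, h (x, F x) := by
  rw [expect, tsum_fintype, Fintype.sum_prod_type, Finset.mul_sum, Finset.mul_sum,
    Finset.sum_filter, Finset.sum_filter, ← Finset.sum_add_distrib]
  refine Finset.sum_congr rfl fun x _ => ?_
  rw [Finset.sum_eq_single (F x)]
  · rw [outcome_groverCircuit F A θ T hT hT0 hTK hs hc]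
    by_cases hx : (x, F x) ∈ A <;> simp only [hx, if_true, if_false, not_true, not_false_eq_true,
      add_zero, zero_add]
  · intro y _ hy
    rw [outcome_groverCircuit F A θ T hT hT0 hTK hs hc, if_neg hy, zero_mul]
  · simp

open Classical in
/-- The distribution of the measured input in a round: every solution has probability `P / T`, and
every other input has probability `(1 - P) / (|X| - T)`. -/
lemma exists_expect_groverRound (F : X → Y) (A : Set (X × Y)) (T : ℕ)
    (hT : (Finset.univ.filter fun x => (x, F x) ∈ A).card = T) (hT0 : 0 < T)
    (hTK : T < Fintype.card X) (r : ℕ) :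
    ∃ P : ℝ, 0 ≤ P ∧ P ≤ 1 ∧
      (√((Fintype.card X : ℝ) / T) ≤ (6 / 5 : ℝ) ^ r → 1 / 4 ≤ P) ∧
      ∀ h : X × Y → ℝ≥0∞, expect (groverRound A r) (fun c => expect (c.outcome F) h) =
        ENNReal.ofReal (P / T) * ∑ x with (x, F x) ∈ A, h (x, F x) +
        ENNReal.ofReal ((1 - P) / ((Fintype.card X : ℝ) - T)) *
          ∑ x with (x, F x) ∉ A, h (x, F x) := by
  set K := Fintype.card X with hK
  have hT' : (0 : ℝ) < T := by exact_mod_cast hT0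
  have hK' : (0 : ℝ) < (K : ℝ) - T := by rw [sub_pos]; exact_mod_cast hTK
  have hK0 : (0 : ℝ) < K := by linarith
  set θ := Real.arcsin √((T : ℝ) / K) with hθ
  have hx0 : 0 < √((T : ℝ) / K) := Real.sqrt_pos.2 (by positivity)
  have hx1 : √((T : ℝ) / K) < 1 := by
    rw [Real.sqrt_lt' one_pos, one_pow, div_lt_one hK0]
    linarith
  have hs' : Real.sin θ = √((T : ℝ) / K) := Real.sin_arcsin (by linarith) hx1.le
  have hs : Real.sin θ = √(T : ℝ) / √(K : ℝ) := by rw [hs', Real.sqrt_div' _ hK0.le]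
  have hc : Real.cos θ = √((K : ℝ) - T) / √(K : ℝ) := by
    rw [hθ, Real.cos_arcsin, Real.sq_sqrt (by positivity), ← Real.sqrt_div' _ hK0.le]
    congr 1
    field_simp
  have hθ0 : 0 < θ := Real.arcsin_pos.2 hx0
  have hθ1 : θ < Real.pi / 2 := Real.arcsin_lt_pi_div_two.2 hx1
  set m := ⌈roundBound X r⌉₊ with hm
  have hm0 : (0 : ℝ) < m := by
    exact_mod_cast Nat.ceil_pos.2 (zero_lt_one.trans_le (one_le_roundBound (X := X) r))
  set S := ∑ j ∈ Finset.range m, Real.sin ((2 * j + 1) * θ) ^ 2 with hS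
  have hS0 : 0 ≤ S := Finset.sum_nonneg fun j _ => sq_nonneg _
  have hCS : ∑ j ∈ Finset.range m, Real.cos ((2 * j + 1) * θ) ^ 2 = m - S := by
    simp only [hS, Real.cos_sq', Finset.sum_sub_distrib]
    simp
  have hS1 : S ≤ m := by
    rw [← sub_nonneg, ← hCS]
    exact Finset.sum_nonneg fun j _ => sq_nonneg _
  refine ⟨S / m, div_nonneg hS0 hm0.le, (div_le_one hm0).2 hS1, fun hr => ?_, fun h => ?_⟩
  · rw [le_div_iff₀ hm0]
    have hmt : √((K : ℝ) / T) ≤ m := by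
      -- The cap `√K` in the round bound does no harm: it is never below the required `√(K / T)`, as
      -- `T ≥ 1`.
      refine le_trans (le_min hr (Real.sqrt_le_sqrt ?_)) (Nat.le_ceil _)
      exact div_le_self hK0.le (by exact_mod_cast hT0)
    have h2 := le_sum_sin_sq (m := m) hθ0 hθ1 (by
      rw [hs']
      calc (1 : ℝ) = √((K : ℝ) / T) * √((T : ℝ) / K) := by
            rw [← Real.sqrt_mul (by positivity)]
            rw [show (K : ℝ) / T * (T / K) = 1 by field_simp, Real.sqrt_one]
        _ ≤ _ := by gcongr)
    linarith
  · have hout := fun j => expect_groverCircuit F A θ T hT hT0 hTK hs hc j h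
    have hm1 : ((m : ℝ≥0∞))⁻¹ = ENNReal.ofReal ((m : ℝ)⁻¹) := by
      rw [ENNReal.ofReal_inv_of_pos hm0, ENNReal.ofReal_natCast]
    rw [groverRound, expect_map, expect_uniformOfFinset]
    simp only [hout, Finset.card_range]
    rw [← hm, Finset.sum_add_distrib, ← Finset.sum_mul, ← Finset.sum_mul,
      ← ENNReal.ofReal_sum_of_nonneg fun j _ => by positivity,
      ← ENNReal.ofReal_sum_of_nonneg fun j _ => by positivity, ← Finset.sum_div,
      ← Finset.sum_div, ← hS, hCS, mul_add, ← mul_assoc, ← mul_assoc, hm1,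
      ← ENNReal.ofReal_mul (by positivity), ← ENNReal.ofReal_mul (by positivity)]
    rw [show (m : ℝ)⁻¹ * (S / T) = S / m / T by ring,
      show (m : ℝ)⁻¹ * ((m - S) / ((Fintype.card X : ℝ) - T)) =
        (1 - S / m) / ((K : ℝ) - T) by rw [← hK]; field_simp]

end Round

/-! ### The cost of a search with an unknown number of solutions -/

/-- The expected number of queries that remain after `r` unsuccessful rounds of Grover's algorithm
for an unknown number of solutions, if from `(6/5)^r ≥ τ` on the rounds succeed with probability at
least `1/4`. -/
def groverPotential (τ : ℝ) (r : ℕ) : ℝ :=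
  if (6 / 5 : ℝ) ^ r < τ then 36 * τ - 10 * (6 / 5 : ℝ) ^ r else 20 * (6 / 5 : ℝ) ^ r

lemma groverPotential_nonneg (τ : ℝ) (r : ℕ) : 0 ≤ groverPotential τ r := by
  have h : (0 : ℝ) < (6 / 5) ^ r := by positivity
  rw [groverPotential]
  split_ifs <;> linarith

lemma groverPotential_zero_le {τ : ℝ} (hτ : 1 ≤ τ) : groverPotential τ 0 ≤ 36 * τ := by
  rw [groverPotential]
  split_ifs
  · norm_num
  · norm_num
    linarith

/-- Write `x = (6/5)^r`. Beyond the threshold, `2x + (3/4) * 20 * (6/5) x = 20x` fixes the constant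
`20`. Before it, nothing is assumed about success, and `2x - 10 * (6/5) x = -10x` fixes the `10`. On
crossing the threshold, `2x + 24x ≤ 36τ - 10x` holds because `x < τ`, which fixes the `36`. -/
lemma groverPotential_step {τ P m : ℝ} {r : ℕ} (hP0 : 0 ≤ P)
    (hP : τ ≤ (6 / 5 : ℝ) ^ r → 1 / 4 ≤ P) (hm : m ≤ 2 * (6 / 5 : ℝ) ^ r) :
    m + (1 - P) * groverPotential τ (r + 1) ≤ groverPotential τ r := by
  have h : (0 : ℝ) < (6 / 5) ^ r := by positivity
  have h0 := groverPotential_nonneg τ (r + 1)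
  rw [groverPotential, pow_succ] at *
  rw [groverPotential]
  set x : ℝ := (6 / 5) ^ r
  rcases lt_or_ge x τ with h1 | h1
  · rw [if_pos h1]
    split_ifs at h0 ⊢ <;> nlinarith
  · have := hP h1
    rw [if_neg (by linarith), if_neg (by linarith)]
    nlinarith

/-! ### Lists of collisions -/

section Lists

variable {X Y : Type}

lemma mem_extending {L : CollisionList X Y} {z : X × Y} :
    z ∈ extending L ↔ (∀ e ∈ L, z.1 ∉ e.1) ∧ ∃ e ∈ L, e.2 = z.2 := Iff.rfl

/-- The entries of `L` are `i`-collisions of `F` with their images, which are distinct. -/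
structure IsCollisionList (F : X → Y) (i : ℕ) (L : CollisionList X Y) : Prop where
  card : ∀ e ∈ L, e.1.card = i
  image : ∀ e ∈ L, ∀ x ∈ e.1, F x = e.2
  nodup : (L.map Prod.snd).Nodup

lemma IsCollisionList.nil (F : X → Y) (i : ℕ) : IsCollisionList F i [] :=
  ⟨by simp, by simp, by simp⟩

lemma IsCollisionList.cons {F : X → Y} {i : ℕ} {L : CollisionList X Y} (hL : IsCollisionList F i L)
    {e : Finset X × Y} (hc : e.1.card = i) (hi : ∀ x ∈ e.1, F x = e.2)
    (hn : ¬ ∃ e' ∈ L, e'.2 = e.2) : IsCollisionList F i (e :: L) := by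
  refine ⟨?_, ?_, ?_⟩
  · rintro e' he'
    rcases List.mem_cons.1 he' with rfl | h
    exacts [hc, hL.card _ h]
  · rintro e' he'
    rcases List.mem_cons.1 he' with rfl | h
    exacts [hi, hL.image _ h]
  · rw [List.map_cons, List.nodup_cons]
    refine ⟨fun h => hn ?_, hL.nodup⟩
    simpa using h

lemma IsCollisionList.eq_of_snd_eq {F : X → Y} {i : ℕ} {L : CollisionList X Y}
    (hL : IsCollisionList F i L) {e e' : Finset X × Y} (he : e ∈ L) (he' : e' ∈ L)
    (h : e.2 = e'.2) : e = e' :=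
  List.inj_on_of_nodup_map hL.nodup he he' h

/-- A solution has its image on the list, so the default branch of `extend` is never taken; the
input is new, so insertion raises the cardinality. -/
lemma extend_spec {F : X → Y} {i : ℕ} {L : CollisionList X Y} (hL : IsCollisionList F i L) {x : X}
    (hx : (x, F x) ∈ extending L) :
    (extend L (x, F x)).2 = F x ∧ (extend L (x, F x)).1.card = i + 1 ∧
      ∀ x' ∈ (extend L (x, F x)).1, F x' = F x := by
  classical
  obtain ⟨h1, e, he, h2⟩ := hx
  rw [extend]
  split
  · rename_i e' he'
    have hmem := List.mem_of_find?_eq_some he'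
    have himg : e'.2 = F x := by simpa using List.find?_some he'
    refine ⟨rfl, ?_, ?_⟩
    · rw [Finset.card_insert_of_notMem (h1 e' hmem), hL.card e' hmem]
    · intro x' hx'
      rcases Finset.mem_insert.1 hx' with rfl | h
      · rfl
      · rw [hL.image e' hmem x' h, himg]
  · rename_i hnone
    rw [List.find?_eq_none] at hnone
    exact absurd h2 (by simpa using hnone e he)

open Classical in
lemma IsCollisionList.length_le_card {F : X → Y} {i : ℕ} {L : CollisionList X Y}
    (hL : IsCollisionList F i L) : L.length = (L.map Prod.snd).toFinset.card := by
  rw [List.toFinset_card_of_nodup hL.nodup, List.length_map]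

variable [Fintype X]

open Classical in
/-- The number of solutions with a given image. -/
lemma card_extending_fiber {F : X → Y} {k i : ℕ} (hF : ∀ y, (F ⁻¹' {y}).ncard = k)
    {L : CollisionList X Y} (hL : IsCollisionList F i L) {y : Y}
    (hy : ∃ e ∈ L, e.2 = y) :
    (Finset.univ.filter fun x => (x, F x) ∈ extending L ∧ F x = y).card = k - i := by
  obtain ⟨e, he, rfl⟩ := hy
  have h : (Finset.univ.filter fun x => (x, F x) ∈ extending L ∧ F x = e.2) =
      (Finset.univ.filter fun x => F x = e.2) \ e.1 := by
    ext x
    simp only [Finset.mem_filter, Finset.mem_univ, true_and, Finset.mem_sdiff, mem_extending]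
    constructor
    · rintro ⟨⟨h1, -⟩, h3⟩
      exact ⟨h3, h1 e he⟩
    · rintro ⟨h1, h2⟩
      refine ⟨⟨fun e' he' hx => h2 ?_, e, he, h1.symm⟩, h1⟩
      -- Images on the list are distinct, so an entry containing `x` must be `e` itself; only `e`
      -- excludes inputs from this fibre.
      rwa [hL.eq_of_snd_eq he he' (by rw [← h1, hL.image e' he' x hx])]
  have hk := hF e.2
  rw [Set.ncard_eq_toFinset_card' (F ⁻¹' {e.2})] at hk
  rw [h, Finset.card_sdiff_of_subset, hL.card e he, ← hk]
  · congr 2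
    ext x
    simp
  · intro x hx
    simpa using hL.image e he x hx

open Classical in
/-- The number of solutions. -/
lemma card_extending {F : X → Y} {k i : ℕ} (hF : ∀ y, (F ⁻¹' {y}).ncard = k)
    {L : CollisionList X Y} (hL : IsCollisionList F i L) :
    (Finset.univ.filter fun x => (x, F x) ∈ extending L).card = L.length * (k - i) := by
  rw [hL.length_le_card, Finset.card_eq_sum_card_fiberwise (f := F)
    (t := (L.map Prod.snd).toFinset), Finset.sum_const_nat]
  · intro y hy
    rw [Finset.filter_filter]
    refine card_extending_fiber hF hL ?_
    simpa using hy
  · intro x hx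
    rw [Finset.mem_coe, Finset.mem_filter] at hx
    obtain ⟨-, -, e, he, h⟩ := hx
    rw [Finset.mem_coe, List.mem_toFinset, List.mem_map]
    exact ⟨e, he, h⟩

open Classical in
/-- The number of solutions whose image is already an image of `M`. -/
lemma card_extending_and_mem_le {F : X → Y} {k i j : ℕ} (hF : ∀ y, (F ⁻¹' {y}).ncard = k)
    {L M : CollisionList X Y} (hL : IsCollisionList F i L) (hM : IsCollisionList F j M) :
    (Finset.univ.filter fun x => (x, F x) ∈ extending L ∧ ∃ e ∈ M, e.2 = F x).card ≤
      M.length * (k - i) := by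
  rw [hM.length_le_card, mul_comm]
  refine Finset.card_le_mul_card_image_of_maps_to (f := F) (fun x hx => ?_) _ fun y _ => ?_
  · simp only [Finset.mem_filter, Finset.mem_univ, true_and] at hx
    obtain ⟨-, e, he, h⟩ := hx
    simp only [List.mem_toFinset, List.mem_map]
    exact ⟨e, he, h⟩
  -- Each fibre has `k - i` solutions if its image is on `L` and none otherwise; only the upper
  -- bound is needed, so `M` may have images outside `L`.
  · by_cases hy : ∃ e ∈ L, e.2 = y
    · rw [← card_extending_fiber hF hL hy]
      refine Finset.card_le_card fun x hx => ?_
      simp only [Finset.mem_filter, Finset.mem_univ, true_and] at hx ⊢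
      exact ⟨hx.1.1, hx.2⟩
    · rw [Finset.card_eq_zero.2]
      · exact Nat.zero_le _
      · rw [Finset.filter_eq_empty_iff]
        rintro x hx rfl
        simp only [Finset.mem_filter, Finset.mem_univ, true_and] at hx
        exact hy hx.1.2

variable [Fintype Y]

open Classical in
lemma card_sub_le_card_freshInputs {F : X → Y} {M : CollisionList X Y}
    (hM : IsCollisionList F 1 M) : Fintype.card X - M.length ≤ (freshInputs M).card := by
  have h : freshInputs M = (M.toFinset.biUnion Prod.fst)ᶜ := by
    ext x
    simp [freshInputs]
  rw [h, Finset.card_compl]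
  refine Nat.sub_le_sub_left ?_ _
  refine (Finset.card_biUnion_le_card_mul _ _ 1 fun e he => ?_).trans ?_
  · exact (hM.card e (List.mem_toFinset.1 he)).le
  · rw [mul_one]
    exact List.toFinset_card_le M

/-- Lets `card_extending`, applied to `M` itself, count the classical samples that would cause a
failure. -/
lemma mem_extending_iff_of_mem_freshInputs {F : X → Y} {M : CollisionList X Y} {x : X}
    (hx : x ∈ freshInputs M) : (x, F x) ∈ extending M ↔ ∃ e ∈ M, e.2 = F x := by
  simp only [freshInputs, Finset.mem_filter, Finset.mem_univ, true_and] at hx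
  exact ⟨fun h => h.2, fun h => ⟨hx, h⟩⟩

end Lists


/-! ### The sizes of the lists -/

section Sizes

variable {k N : ℕ}

lemma two_pow_sub_one_pos (hk : 1 ≤ k) : (0 : ℝ) < 2 ^ k - 1 := by
  have : (1 : ℝ) < 2 ^ k := one_lt_pow₀ (by norm_num) (by omega)
  linarith

lemma exponent_nonneg (k i : ℕ) : 0 ≤ exponent k i := by
  have h (n : ℕ) : (0 : ℝ) ≤ 2 ^ n - 1 := sub_nonneg.2 (one_le_pow₀ (by norm_num))
  exact div_nonneg (h _) (h _)

lemma exponent_le_one (k i : ℕ) : exponent k i ≤ 1 := by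
  have h (n : ℕ) : (0 : ℝ) ≤ 2 ^ n - 1 := sub_nonneg.2 (one_le_pow₀ (by norm_num))
  refine div_le_one_of_le₀ ?_ (h _)
  have : (2 : ℝ) ^ (k - i) ≤ 2 ^ k := pow_le_pow_right₀ (by norm_num) (Nat.sub_le _ _)
  linarith

lemma exponent_zero (hk : 1 ≤ k) : exponent k 0 = 1 := by
  rw [exponent, Nat.sub_zero, div_self (two_pow_sub_one_pos hk).ne']

/-- The recursion satisfied by the exponents. -/
lemma two_mul_exponent_succ (hk : 1 ≤ k) {i : ℕ} (hi : i < k) :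
    2 * exponent k (i + 1) = exponent k i - 1 / ((2 : ℝ) ^ k - 1) := by
  have h := (two_pow_sub_one_pos hk).ne'
  rw [exponent, exponent, show k - i = (k - (i + 1)) + 1 by omega, pow_succ]
  field_simp
  ring

lemma one_le_idealSize (hN : 1 ≤ N) (i : ℕ) : 1 ≤ idealSize k N i :=
  Real.one_le_rpow (by exact_mod_cast hN) (exponent_nonneg k i)

lemma idealSize_le_listSize (i : ℕ) : idealSize k N i ≤ listSize k N i := Nat.le_ceil _

lemma listSize_le_two_mul (hN : 1 ≤ N) (i : ℕ) : (listSize k N i : ℝ) ≤ 2 * idealSize k N i := by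
  have h := one_le_idealSize (k := k) hN i
  have := Nat.ceil_lt_add_one (zero_le_one.trans h)
  rw [listSize]
  linarith

lemma listSize_pos (hN : 1 ≤ N) (i : ℕ) : 0 < listSize k N i :=
  Nat.ceil_pos.2 (zero_lt_one.trans_le (one_le_idealSize hN i))

lemma listSize_le (hN : 1 ≤ N) (i : ℕ) : listSize k N i ≤ N := by
  refine Nat.ceil_le.2 ?_
  calc idealSize k N i ≤ (N : ℝ) ^ (1 : ℝ) :=
        Real.rpow_le_rpow_of_exponent_le (by exact_mod_cast hN) (exponent_le_one k i)
    _ = N := Real.rpow_one _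

lemma listSize_zero (hk : 1 ≤ k) : listSize k N 0 = N := by
  simp [listSize, idealSize, exponent_zero hk]

end Sizes

/-! ### Potential functions -/

/-- The contribution of the collisions that are still to be found after the next one, if `m`
`i`-collisions are on the list and each `j`-collision costs `v j`. -/
def remaining (k N : ℕ) (v : ℕ → ℝ≥0∞) (i m : ℕ) : ℝ≥0∞ :=
  ((listSize k N i - (m + 1) : ℕ) : ℝ≥0∞) * v i +
    ∑ j ∈ Finset.Ioc i k, (listSize k N j : ℝ≥0∞) * v j

/-- The search for the first entry of a new list is split off from the rest. It serves the passage
between levels and, at `i = 0`, gives the initial value of the potential. -/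
lemma add_remaining_zero {k N : ℕ} (hN : 1 ≤ N) (v : ℕ → ℝ≥0∞) {i : ℕ} (hi : i < k) :
    v (i + 1) + remaining k N v (i + 1) 0 =
      ∑ j ∈ Finset.Ioc i k, (listSize k N j : ℝ≥0∞) * v j := by
  have h : Finset.Ioc i k = insert (i + 1) (Finset.Ioc (i + 1) k) := by
    ext j
    simp only [Finset.mem_Ioc, Finset.mem_insert]
    omega
  rw [h, Finset.sum_insert (by simp), remaining, ← add_assoc]
  congr 1
  obtain ⟨n, hn⟩ := Nat.exists_eq_succ_of_ne_zero (listSize_pos (k := k) hN (i + 1)).ne'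
  rw [hn]
  push_cast [Nat.succ_eq_add_one, Nat.zero_add, Nat.add_sub_cancel]
  ring

lemma add_remaining_succ {k N : ℕ} (v : ℕ → ℝ≥0∞) {i m : ℕ} (h : m + 1 < listSize k N i) :
    v i + remaining k N v i (m + 1) = remaining k N v i m := by
  rw [remaining, remaining, ← add_assoc]
  congr 1
  obtain ⟨n, hn⟩ := Nat.exists_eq_add_of_lt h
  rw [hn, show m + 1 + n + 1 - (m + 1 + 1) = n by omega,
    show m + 1 + n + 1 - (m + 1) = n + 1 by omega]
  push_cast
  ring

/-! ### The potential along the multi-collision algorithm -/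

section Potential

variable {X Y : Type} [Fintype Y]

/-- The invariant of the algorithm while it collects `i`-collisions. -/
structure IsCollecting (F : X → Y) (k i : ℕ) (L M : CollisionList X Y) : Prop where
  one_le : 1 ≤ i
  le : i ≤ k
  length_lt : M.length < listSize k (Fintype.card Y) i
  current : IsCollisionList F i M
  previous : 2 ≤ i → IsCollisionList F (i - 1) L
  length_previous : 2 ≤ i → L.length = listSize k (Fintype.card Y) (i - 1)

open Classical in
/-- A potential in which the current collision contributes `u i r` after `r` unsuccessful rounds,
every later `i`-collision contributes `u i 0`, and failure contributes `a`. -/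
def potential (F : X → Y) (k : ℕ) (u : ℕ → ℕ → ℝ≥0∞) (a : ℝ≥0∞) : CollisionState X Y → ℝ≥0∞
  | .collect i L M r =>
      if IsCollecting F k i L M then
        u i r + remaining k (Fintype.card Y) (fun j => u j 0) i M.length
      -- The infinite value makes the invariant a consequence of a finite expectation; the
      -- supermartingale inequality is trivial at such states.
      else ⊤
  | .done none => a
  | .done (some S) => if IsCollision F k S then 0 else ⊤

lemma potential_collect {F : X → Y} {k i : ℕ} {L M : CollisionList X Y}
    (h : IsCollecting F k i L M) (u : ℕ → ℕ → ℝ≥0∞) (a : ℝ≥0∞) (r : ℕ) :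
    potential F k u a (.collect i L M r) =
      u i r + remaining k (Fintype.card Y) (fun j => u j 0) i M.length := by
  rw [potential, if_pos h]

-- If the new image is not yet on the list, each way of continuing leaves at most `remaining`: the
-- next search on the same list, the first search of the next list, or a correct output of value
-- zero.
open Classical in
lemma potential_addCollision_le {F : X → Y} {k i : ℕ} {L M : CollisionList X Y}
    (hY : 1 ≤ Fintype.card Y) (h : IsCollecting F k i L M) (u : ℕ → ℕ → ℝ≥0∞) (a : ℝ≥0∞)
    {e : Finset X × Y} (hc : e.1.card = i) (hi : ∀ x ∈ e.1, F x = e.2) :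
    potential F k u a (addCollision k i L M e) ≤ (if ∃ e' ∈ M, e'.2 = e.2 then a else 0) +
      remaining k (Fintype.card Y) (fun j => u j 0) i M.length := by
  rw [addCollision]
  by_cases h1 : ∃ e' ∈ M, e'.2 = e.2
  · rw [if_pos h1, if_pos h1, potential]
    exact le_self_add
  rw [if_neg h1, if_neg h1, zero_add]
  have hM := h.current.cons hc hi h1
  split_ifs with h2 h3
  · rw [potential_collect ⟨h.one_le, h.le, by simpa using h2, hM, h.previous, h.length_previous⟩,
      List.length_cons, add_remaining_succ (fun j => u j 0) h2]
  · have hlen : (e :: M).length = listSize k (Fintype.card Y) i := by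
      have := h.length_lt
      rw [List.length_cons]
      omega
    rw [potential_collect ⟨by omega, by omega, by simpa using listSize_pos hY _,
      IsCollisionList.nil F _, fun _ => by simpa using hM, fun _ => by simpa using hlen⟩,
      List.length_nil, add_remaining_zero hY (fun j => u j 0) h3]
    exact le_add_self
  · have hik : i = k := le_antisymm h.le (not_lt.1 h3)
    have hcoll : IsCollision F k e.1 :=
      ⟨hc.trans hik, fun x hx x' hx' => (hi x hx).trans (hi x' hx').symm⟩
    rw [potential, if_pos hcoll]
    exact zero_le

lemma sum_le_of_le_ite_add {ι : Type*} (s : Finset ι) (p : ι → Prop) [DecidablePred p]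
    {f : ι → ℝ≥0∞} {a R : ℝ≥0∞} {B : ℕ} (hB : (s.filter p).card ≤ B)
    (hf : ∀ x ∈ s, f x ≤ (if p x then a else 0) + R) :
    ∑ x ∈ s, f x ≤ B * a + s.card * R := by
  refine (Finset.sum_le_sum hf).trans ?_
  rw [Finset.sum_add_distrib, ← Finset.sum_filter, Finset.sum_const, Finset.sum_const,
    nsmul_eq_mul, nsmul_eq_mul]
  gcongr

variable {F : X → Y} {k : ℕ} [Fintype X]

/-- Fewer than `listSize ≤ N` of the `kN` inputs are used up. Strictness keeps the set of fresh
inputs nonempty even for `k = 1`. -/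
lemma card_freshInputs_ge (hX : Fintype.card X = k * Fintype.card Y) {i : ℕ} (hi : i = 1)
    {L M : CollisionList X Y} (h : IsCollecting F k i L M) (hY : 1 ≤ Fintype.card Y) :
    (k - 1) * Fintype.card Y < (freshInputs M).card := by
  subst hi
  have h1 := card_sub_le_card_freshInputs h.current
  have h2 := h.length_lt.trans_le (listSize_le hY _)
  have h3 := h.le
  refine lt_of_lt_of_le ?_ h1
  obtain ⟨n, rfl⟩ := Nat.exists_eq_add_of_le h3
  rw [hX, add_mul, Nat.add_sub_cancel_left, one_mul]
  omega

lemma freshInputs_nonempty (hX : Fintype.card X = k * Fintype.card Y) {i : ℕ} (hi : i ≤ 1)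
    {L M : CollisionList X Y} (h : IsCollecting F k i L M) (hY : 1 ≤ Fintype.card Y) :
    (freshInputs M).Nonempty := by
  rw [← Finset.card_pos]
  exact (Nat.zero_le _).trans_lt (card_freshInputs_ge hX (le_antisymm hi h.one_le) h hY)

variable [AddCommGroup Y] [Nonempty X]

lemma action_collect_of_le_one {i : ℕ} {L M : CollisionList X Y} {r : ℕ} (hi : i ≤ 1)
    (h : (freshInputs M).Nonempty) :
    (collisionAlgorithm X Y k).action (.collect i L M r) =
      .run ((PMF.uniformOfFinset (freshInputs M) h).map classicalQuery)
        fun z => addCollision k i L M ({z.1}, z.2) := by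
  simp only [collisionAlgorithm, hi, h, if_true, dif_pos]

open Classical in
lemma action_collect_of_two_le {i : ℕ} {L M : CollisionList X Y} {r : ℕ} (hi : 2 ≤ i) :
    (collisionAlgorithm X Y k).action (.collect i L M r) =
      .run (groverRound (extending L) r) fun z =>
        if z ∈ extending L then addCollision k i L M (extend L z)
        else .collect i L M (r + 1) := by
  have : ¬ i ≤ 1 := by omega
  simp only [collisionAlgorithm, this, if_false]

lemma action_done (result : Option (Finset X)) :
    (collisionAlgorithm X Y k).action (.done result) = .halt result := rfl

lemma one_le_queries_of_action (s : CollisionState X Y) (c : PMF (QCircuit X Y))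
    (next : X × Y → CollisionState X Y) (h : (collisionAlgorithm X Y k).action s = .run c next) :
    ∀ circ ∈ c.support, 1 ≤ circ.queries := by
  cases s with
  | done result => cases h
  | collect i L M r =>
    rcases Nat.lt_or_ge 1 i with hi | hi
    · rw [action_collect_of_two_le hi] at h
      cases h
      exact one_le_queries_of_mem_groverRound _ _
    · by_cases hne : (freshInputs M).Nonempty
      · rw [action_collect_of_le_one hi hne] at h
        cases h
        intro circ hc
        rw [PMF.mem_support_map_iff] at hc
        obtain ⟨x, -, rfl⟩ := hc
        simp [QCircuit.queries, classicalQuery]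
      · simp only [collisionAlgorithm, hi, hne, if_true, dif_neg, not_false_eq_true] at h
        cases h

/-- A step costs one query and fails with probability at most `|M| / N`: the bad inputs number `|M|
(k - 1)`, among more than `(k - 1) N` fresh ones. The value of `remaining` occurs on both sides, so
the condition `hu` concerns only the current collision. -/
lemma expect_step_collect_one (hX : Fintype.card X = k * Fintype.card Y)
    (hF : ∀ y, (F ⁻¹' {y}).ncard = k) (hY : 1 ≤ Fintype.card Y) {i : ℕ} (hi : i = 1)
    {L M : CollisionList X Y} (h : IsCollecting F k i L M) (u : ℕ → ℕ → ℝ≥0∞) (a κ : ℝ≥0∞)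
    (r q : ℕ) (hu : κ + a * (M.length / (Fintype.card Y : ℝ≥0∞)) ≤ u i r) :
    expect ((collisionAlgorithm X Y k).step F (.collect i L M r, q))
        (fun s => κ * s.2 + potential F k u a s.1) ≤
      κ * q + potential F k u a (.collect i L M r) := by
  classical
  have hfr := card_freshInputs_ge hX hi h hY
  have hne := freshInputs_nonempty hX hi.le h hY
  subst hi
  set R := remaining k (Fintype.card Y) (fun j => u j 0) 1 M.length with hR
  set c := (freshInputs M).card with hc
  have hc0 : (c : ℝ≥0∞) ≠ 0 := by
    have := Finset.card_pos.2 hne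
    exact_mod_cast this.ne'
  have hct : (c : ℝ≥0∞) ≠ ⊤ := ENNReal.natCast_ne_top c
  have hq (x : X) : (classicalQuery x : QCircuit X Y).queries = 1 := rfl
  have hstep : expect ((collisionAlgorithm X Y k).step F (.collect 1 L M r, q))
      (fun s => κ * s.2 + potential F k u a s.1) =
      expect ((PMF.uniformOfFinset (freshInputs M) hne).map classicalQuery) fun c =>
        expect (c.outcome F) fun z => κ * ((q + c.queries : ℕ) : ℝ≥0∞) +
          potential F k u a (addCollision k 1 L M ({z.1}, z.2)) :=
    QAlgorithm.expect_step_of_run _ F (action_collect_of_le_one le_rfl hne) _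
  rw [hstep, expect_map]
  simp only [expect_classicalQuery, hq]
  rw [expect_add, expect_const, expect_uniformOfFinset, potential_collect h, ← hR, ← hc]
  have hsum := sum_le_of_le_ite_add (freshInputs M) (fun x => ∃ e ∈ M, e.2 = F x)
    (f := fun x => potential F k u a (addCollision k 1 L M ({x}, F x))) (a := a) (R := R)
    (B := M.length * (k - 1)) (by
      rw [← card_extending hF h.current]
      refine Finset.card_le_card fun x hx => ?_
      rw [Finset.mem_filter] at hx ⊢
      exact ⟨Finset.mem_univ _, (mem_extending_iff_of_mem_freshInputs hx.1).2 hx.2⟩)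
    fun x _ => potential_addCollision_le hY h u a (e := ({x}, F x)) (by simp) (by simp)
  have hB : (c : ℝ≥0∞)⁻¹ * ((M.length * (k - 1) : ℕ) : ℝ≥0∞) ≤
      M.length / (Fintype.card Y : ℝ≥0∞) := by
    rw [ENNReal.le_div_iff_mul_le (.inl (by exact_mod_cast Nat.one_le_iff_ne_zero.1 hY)) (.inl (by simp)), mul_assoc,
      ENNReal.inv_mul_le_iff hc0 hct]
    norm_cast
    rw [mul_assoc, mul_comm c]
    exact Nat.mul_le_mul_left _ hfr.le
  calc κ * ((q + 1 : ℕ) : ℝ≥0∞) + (c : ℝ≥0∞)⁻¹ * _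
      ≤ κ * ((q + 1 : ℕ) : ℝ≥0∞) +
        (c : ℝ≥0∞)⁻¹ * (((M.length * (k - 1) : ℕ) : ℝ≥0∞) * a + c * R) := by gcongr
    _ = κ * q + (κ + a * ((c : ℝ≥0∞)⁻¹ * ((M.length * (k - 1) : ℕ) : ℝ≥0∞))) + R := by
        rw [mul_add (c : ℝ≥0∞)⁻¹, ← mul_assoc _ _ R, ENNReal.inv_mul_cancel hc0 hct]
        push_cast
        ring
    _ ≤ κ * q + (κ + a * (M.length / (Fintype.card Y : ℝ≥0∞))) + R := by gcongr
    _ ≤ κ * q + u 1 r + R := by gcongr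
    _ = _ := add_assoc _ _ _

/-- Given success, the solution is uniform and each image carries the same number of solutions, so
failure has conditional probability at most `|M| / |L|`; given no success, only `r` changes. Since
`P` depends on the state and the round, `hu` is required for every admissible `P`. -/
lemma expect_step_collect (hX : Fintype.card X = k * Fintype.card Y)
    (hF : ∀ y, (F ⁻¹' {y}).ncard = k) (hY : 1 ≤ Fintype.card Y) {i : ℕ} (hi : 2 ≤ i)
    {L M : CollisionList X Y} (h : IsCollecting F k i L M) (u : ℕ → ℕ → ℝ≥0∞) (a κ : ℝ≥0∞)
    (r q : ℕ)
    (hu : ∀ P : ℝ, 0 ≤ P → P ≤ 1 →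
      (√((k : ℝ) * Fintype.card Y / listSize k (Fintype.card Y) (i - 1)) ≤ (6 / 5 : ℝ) ^ r →
        1 / 4 ≤ P) →
      κ * ENNReal.ofReal (2 * (6 / 5 : ℝ) ^ r) + ENNReal.ofReal P *
        (a * (M.length / (listSize k (Fintype.card Y) (i - 1) : ℝ≥0∞))) +
        ENNReal.ofReal (1 - P) * u i (r + 1) ≤ u i r) :
    expect ((collisionAlgorithm X Y k).step F (.collect i L M r, q))
        (fun s => κ * s.2 + potential F k u a s.1) ≤
      κ * q + potential F k u a (.collect i L M r) := by
  classical
  have hik := h.le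
  have hL := h.previous hi
  have hcard := card_extending hF hL
  rw [h.length_previous hi] at hcard
  set N := Fintype.card Y with hN
  set R := remaining k N (fun j => u j 0) i M.length with hR
  set l := listSize k N (i - 1) with hl
  set d := k - (i - 1) with hd
  have hl0 : 0 < l := listSize_pos hY _
  have hlN : l ≤ N := listSize_le hY _
  have hd0 : 0 < d := by omega
  have hT0 : 0 < l * d := Nat.mul_pos hl0 hd0
  -- Strictness comes from `i ≥ 2`, hence `d < k`; it keeps the Grover angle below `π/2`.
  have hTK : l * d < Fintype.card X := by
    rw [hX, mul_comm k]
    exact Nat.mul_lt_mul_of_le_of_lt hlN (by omega) hY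
  obtain ⟨P, hP0, hP1, hP, hPe⟩ := exists_expect_groverRound F (extending L) _ hcard hT0 hTK r
  have hT : (0 : ℝ) < (l * d : ℕ) := by exact_mod_cast hT0
  have hKT : (0 : ℝ) < (Fintype.card X : ℝ) - (l * d : ℕ) := by
    rw [sub_pos]
    exact_mod_cast hTK
  have hcomp : (((Finset.univ.filter fun x => (x, F x) ∉ extending L).card : ℕ) : ℝ) =
      (Fintype.card X : ℝ) - (l * d : ℕ) := by
    rw [← Finset.compl_filter, Finset.card_compl, hcard, Nat.cast_sub hTK.le]
  have hstep : expect ((collisionAlgorithm X Y k).step F (.collect i L M r, q))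
      (fun s => κ * s.2 + potential F k u a s.1) =
      expect (groverRound (extending L) r) fun c => expect (c.outcome F) fun z =>
        κ * ((q + c.queries : ℕ) : ℝ≥0∞) + potential F k u a
          (if z ∈ extending L then addCollision k i L M (extend L z)
            else .collect i L M (r + 1)) :=
    QAlgorithm.expect_step_of_run _ F (action_collect_of_two_le hi) _
  rw [hstep]
  simp only [expect_add, expect_const, Nat.cast_add, mul_add]
  rw [hPe, potential_collect h, ← hN, ← hR]
  have hκ : expect (groverRound (extending L) r) (fun c => κ * (c.queries : ℝ≥0∞)) ≤
      κ * ENNReal.ofReal (2 * (6 / 5 : ℝ) ^ r) := by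
    simp only [mul_comm κ, expect_mul_const]
    rw [expect_groverRound_queries]
    gcongr
    rw [← ENNReal.ofReal_natCast]
    exact ENNReal.ofReal_le_ofReal (ceil_roundBound_le r)
  have hgood : ∑ x with (x, F x) ∈ extending L, potential F k u a
      (if (x, F x) ∈ extending L then addCollision k i L M (extend L (x, F x))
        else .collect i L M (r + 1)) ≤
      ((M.length * d : ℕ) : ℝ≥0∞) * a + ((l * d : ℕ) : ℝ≥0∞) * R := by
    rw [← hcard]
    refine sum_le_of_le_ite_add _ (fun x => ∃ e ∈ M, e.2 = F x) ?_ fun x hx => ?_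
    · rw [Finset.filter_filter]
      exact card_extending_and_mem_le hF hL h.current
    · have hx' := (Finset.mem_filter.1 hx).2
      obtain ⟨e1, e2, e3⟩ := extend_spec hL hx'
      have hp := potential_addCollision_le hY h u a (e2.trans (by omega))
        fun x' hx' => (e3 x' hx').trans e1.symm
      rw [e1] at hp
      rwa [if_pos hx']
  have hbad : ∑ x with (x, F x) ∉ extending L, potential F k u a
      (if (x, F x) ∈ extending L then addCollision k i L M (extend L (x, F x))
        else .collect i L M (r + 1)) =
      ENNReal.ofReal ((Fintype.card X : ℝ) - (l * d : ℕ)) * (u i (r + 1) + R) := by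
    rw [Finset.sum_congr rfl (g := fun _ => u i (r + 1) + R), Finset.sum_const, nsmul_eq_mul,
      ← hcomp, ENNReal.ofReal_natCast]
    intro x hx
    rw [if_neg (Finset.mem_filter.1 hx).2, potential_collect h]
  have hw1 : ENNReal.ofReal (P / (l * d : ℕ)) * ((l * d : ℕ) : ℝ≥0∞) = ENNReal.ofReal P := by
    rw [← ENNReal.ofReal_natCast, ← ENNReal.ofReal_mul (by positivity), div_mul_cancel₀ _ hT.ne']
  have hw2 : ENNReal.ofReal (P / (l * d : ℕ)) * ((M.length * d : ℕ) : ℝ≥0∞) =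
      ENNReal.ofReal P * (M.length / (l : ℝ≥0∞)) := by
    have hl' : (0 : ℝ) < l := by exact_mod_cast hl0
    have hd' : (0 : ℝ) < d := by exact_mod_cast hd0
    rw [← ENNReal.ofReal_natCast (M.length * d), ← ENNReal.ofReal_natCast M.length,
      ← ENNReal.ofReal_natCast l, ← ENNReal.ofReal_div_of_pos hl',
      ← ENNReal.ofReal_mul (by positivity), ← ENNReal.ofReal_mul hP0]
    congr 1
    push_cast
    field_simp
  have hw3 : ENNReal.ofReal ((1 - P) / ((Fintype.card X : ℝ) - (l * d : ℕ))) *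
      ENNReal.ofReal ((Fintype.card X : ℝ) - (l * d : ℕ)) = ENNReal.ofReal (1 - P) := by
    rw [← ENNReal.ofReal_mul (div_nonneg (by linarith) hKT.le), div_mul_cancel₀ _ hKT.ne']
  have hw4 : ENNReal.ofReal P + ENNReal.ofReal (1 - P) = 1 := by
    rw [← ENNReal.ofReal_add hP0 (by linarith)]
    simp
  rw [hbad, ← mul_assoc, hw3]
  have hu' := hu P hP0 hP1 fun hr => hP (le_trans (Real.sqrt_le_sqrt ?_) hr)
  · calc _ ≤ κ * q + κ * ENNReal.ofReal (2 * (6 / 5 : ℝ) ^ r) +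
          (ENNReal.ofReal (P / (l * d : ℕ)) *
            (((M.length * d : ℕ) : ℝ≥0∞) * a + ((l * d : ℕ) : ℝ≥0∞) * R) +
          ENNReal.ofReal (1 - P) * (u i (r + 1) + R)) := by gcongr
      _ = κ * q + (κ * ENNReal.ofReal (2 * (6 / 5 : ℝ) ^ r) +
          a * (ENNReal.ofReal (P / (l * d : ℕ)) * ((M.length * d : ℕ) : ℝ≥0∞)) +
          ENNReal.ofReal (1 - P) * u i (r + 1)) +
          (ENNReal.ofReal (P / (l * d : ℕ)) * ((l * d : ℕ) : ℝ≥0∞) + ENNReal.ofReal (1 - P)) *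
            R := by ring
      _ = κ * q + (κ * ENNReal.ofReal (2 * (6 / 5 : ℝ) ^ r) +
          ENNReal.ofReal P * (a * (M.length / (l : ℝ≥0∞))) +
          ENNReal.ofReal (1 - P) * u i (r + 1)) + R := by
        rw [hw1, hw2, hw4, one_mul, mul_left_comm a]
      _ ≤ κ * q + u i r + R := by gcongr
      _ = _ := add_assoc _ _ _
  -- There are `l * d ≥ l` solutions, so the threshold stated with `l` alone implies the actual one.
  · rw [hX, Nat.cast_mul]
    have hl' : (0 : ℝ) < l := by exact_mod_cast hl0
    gcongr
    exact_mod_cast Nat.le_mul_of_pos_right l hd0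

/-- A potential that does not increase in expectation while collisions are collected bounds the
expected final value. -/
lemma expect_dist_potential_le (hk : 1 ≤ k) (hX : Fintype.card X = k * Fintype.card Y)
    (hF : ∀ y, (F ⁻¹' {y}).ncard = k) (hY : 1 ≤ Fintype.card Y) (u : ℕ → ℕ → ℝ≥0∞) (a κ : ℝ≥0∞)
    (h1 : ∀ m r, m < listSize k (Fintype.card Y) 1 →
      κ + a * ((m : ℝ≥0∞) / (Fintype.card Y : ℝ≥0∞)) ≤ u 1 r)
    (h2 : ∀ i m r, 2 ≤ i → i ≤ k → m < listSize k (Fintype.card Y) i →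
      ∀ P : ℝ, 0 ≤ P → P ≤ 1 →
      (√((k : ℝ) * Fintype.card Y / listSize k (Fintype.card Y) (i - 1)) ≤ (6 / 5 : ℝ) ^ r →
        1 / 4 ≤ P) →
      κ * ENNReal.ofReal (2 * (6 / 5 : ℝ) ^ r) + ENNReal.ofReal P *
        (a * ((m : ℝ≥0∞) / (listSize k (Fintype.card Y) (i - 1) : ℝ≥0∞))) +
        ENNReal.ofReal (1 - P) * u i (r + 1) ≤ u i r) (n : ℕ) :
    expect ((collisionAlgorithm X Y k).dist F n) (fun s => κ * s.2 + potential F k u a s.1) ≤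
      ∑ i ∈ Finset.Ioc 0 k, (listSize k (Fintype.card Y) i : ℝ≥0∞) * u i 0 := by
  classical
  refine (QAlgorithm.expect_dist_le (collisionAlgorithm X Y k) F
    (fun s => κ * s.2 + potential F k u a s.1) ?_ n).trans ?_
  · rintro ⟨s, q⟩
    cases s with
    | done result =>
      rw [QAlgorithm.step_of_halt _ F (action_done (k := k) result), expect_pure]
    | collect i L M r =>
      by_cases h : IsCollecting F k i L M
      · rcases Nat.lt_or_ge 1 i with hi | hi
        · exact expect_step_collect hX hF hY hi h u a κ r q (h2 i _ r hi h.le h.length_lt)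
        · have hi' : i = 1 := le_antisymm hi h.one_le
          refine expect_step_collect_one hX hF hY hi' h u a κ r q ?_
          subst hi'
          exact h1 _ r h.length_lt
      · simp [potential, h]
  · have hstart : IsCollecting F k 1 [] [] := ⟨le_rfl, hk, by simpa using listSize_pos hY 1,
      IsCollisionList.nil F 1, by simp, by simp⟩
    change κ * ((0 : ℕ) : ℝ≥0∞) + potential F k u a (.collect 1 [] [] 0) ≤ _
    rw [potential_collect hstart, List.length_nil, Nat.cast_zero, mul_zero, zero_add]
    exact (add_remaining_zero hY (fun j => u j 0) hk).le

end Potential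


/-! ### The expected number of queries and the probability of failure -/

section Sizes

variable {k N : ℕ}

/-- The recursion makes `exponent k (i + 1) + (1 - exponent k i) / 2` independent of `i`; at `i = 0`
it equals `exponent k 1`. -/
lemma idealSize_succ_mul_sqrt (hk : 1 ≤ k) (hN : 1 ≤ N) {i : ℕ} (hi : i < k) :
    idealSize k N (i + 1) * √((N : ℝ) / idealSize k N i) = idealSize k N 1 := by
  have hN' : (0 : ℝ) < N := by exact_mod_cast hN
  have e1 := two_mul_exponent_succ hk hi
  have e2 := two_mul_exponent_succ hk (i := 0) hk
  rw [exponent_zero hk, zero_add] at e2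
  have h : (N : ℝ) / idealSize k N i = (N : ℝ) ^ (1 - exponent k i) := by
    rw [Real.rpow_sub hN', Real.rpow_one, idealSize]
  rw [h, Real.sqrt_eq_rpow, ← Real.rpow_mul hN'.le, idealSize, ← Real.rpow_add hN', idealSize]
  congr 1
  linarith

lemma idealSize_sq_div (hk : 1 ≤ k) (hN : 1 ≤ N) {i : ℕ} (hi : i < k) :
    idealSize k N (i + 1) ^ 2 / idealSize k N i = (N : ℝ) ^ (-(1 / ((2 : ℝ) ^ k - 1))) := by
  have hN' : (0 : ℝ) < N := by exact_mod_cast hN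
  have e1 := two_mul_exponent_succ hk hi
  rw [idealSize, idealSize, ← Real.rpow_natCast, ← Real.rpow_mul hN'.le, ← Real.rpow_sub hN']
  congr 1
  push_cast
  linarith

/-- Rounding up at most doubles a size that is at least one, which gives `72 = 2 * 36`; the factor
`k` is the crude bound `√k ≤ k`. -/
lemma listSize_mul_sqrt_le (hk : 1 ≤ k) (hN : 1 ≤ N) {i : ℕ} (hi : i < k) :
    (listSize k N (i + 1) : ℝ) * (36 * √((k : ℝ) * N / listSize k N i)) ≤
      72 * k * idealSize k N 1 := by
  have hk' : (1 : ℝ) ≤ k := by exact_mod_cast hk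
  have h1 := one_le_idealSize (k := k) hN i
  have h2 : √((k : ℝ) * N / listSize k N i) ≤ k * √((N : ℝ) / idealSize k N i) := by
    rw [mul_div_assoc, Real.sqrt_mul (by positivity)]
    gcongr
    · rw [Real.sqrt_le_left (by positivity)]
      nlinarith
    · exact idealSize_le_listSize i
  calc (listSize k N (i + 1) : ℝ) * (36 * √((k : ℝ) * N / listSize k N i))
      ≤ 2 * idealSize k N (i + 1) * (36 * (k * √((N : ℝ) / idealSize k N i))) := by
        have h3 := listSize_le_two_mul (k := k) hN (i + 1)
        have h4 := (Nat.cast_nonneg _).trans h3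
        gcongr
    _ = 72 * k * (idealSize k N (i + 1) * √((N : ℝ) / idealSize k N i)) := by ring
    _ = _ := by rw [idealSize_succ_mul_sqrt hk hN hi]

/-- Rounding two numerators costs the factor `4`. The true exponent is `-1/(2^k - 1)`, weakened at
the end to `-1/2^k`. -/
lemma listSize_sq_div_le (hk : 1 ≤ k) (hN : 1 ≤ N) {i : ℕ} (hi : i < k) :
    (listSize k N (i + 1) : ℝ) * (listSize k N (i + 1) / listSize k N i) ≤
      4 * (N : ℝ) ^ (-(1 : ℝ) / (2 : ℝ) ^ k) := by
  have h1 := one_le_idealSize (k := k) hN i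
  have h2 := one_le_idealSize (k := k) hN (i + 1)
  have hp := two_pow_sub_one_pos hk
  calc (listSize k N (i + 1) : ℝ) * (listSize k N (i + 1) / listSize k N i)
      ≤ 2 * idealSize k N (i + 1) * (2 * idealSize k N (i + 1) / idealSize k N i) := by
        gcongr
        · exact listSize_le_two_mul hN _
        · exact listSize_le_two_mul hN _
        · exact idealSize_le_listSize i
    _ = 4 * (idealSize k N (i + 1) ^ 2 / idealSize k N i) := by ring
    _ = 4 * (N : ℝ) ^ (-(1 / ((2 : ℝ) ^ k - 1))) := by rw [idealSize_sq_div hk hN hi]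
    _ ≤ _ := by
        gcongr
        · exact_mod_cast hN
        · rw [neg_div]
          gcongr
          linarith

lemma sum_Ioc_le {f : ℕ → ℝ≥0∞} {c : ℝ} (h : ∀ i < k, f (i + 1) ≤ ENNReal.ofReal c) :
    ∑ i ∈ Finset.Ioc 0 k, f i ≤ ENNReal.ofReal (k * c) := by
  calc ∑ i ∈ Finset.Ioc 0 k, f i ≤ ∑ i ∈ Finset.Ioc 0 k, ENNReal.ofReal c := by
        refine Finset.sum_le_sum fun i hi => ?_
        rw [Finset.mem_Ioc] at hi
        obtain ⟨j, rfl⟩ := Nat.exists_eq_succ_of_ne_zero hi.1.ne'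
        exact h j hi.2
    _ = ENNReal.ofReal (k * c) := by
        rw [Finset.sum_const, Nat.card_Ioc, Nat.sub_zero, nsmul_eq_mul,
          ENNReal.ofReal_mul (Nat.cast_nonneg k), ENNReal.ofReal_natCast]

end Sizes

/-- The contribution to the expected number of queries of an `i`-collision after `r` unsuccessful
rounds. -/
def queryWeight (k N i r : ℕ) : ℝ≥0∞ :=
  if i ≤ 1 then 1
  else ENNReal.ofReal (groverPotential √((k : ℝ) * N / listSize k N (i - 1)) r)

/-- The contribution of an `i`-collision to the probability of failure. -/
def failureWeight (k N i : ℕ) : ℝ≥0∞ := (listSize k N i : ℝ≥0∞) / listSize k N (i - 1)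

section Weights

variable {k N : ℕ}

lemma sum_queryWeight_le (hk : 1 ≤ k) (hN : 1 ≤ N) :
    ∑ i ∈ Finset.Ioc 0 k, (listSize k N i : ℝ≥0∞) * queryWeight k N i 0 ≤
      ENNReal.ofReal (k * (72 * k * idealSize k N 1)) := by
  have hk' : (1 : ℝ) ≤ k := by exact_mod_cast hk
  refine sum_Ioc_le fun i hi => ?_
  rw [queryWeight]
  split_ifs with h
  · obtain rfl : i = 0 := by omega
    rw [mul_one, ← ENNReal.ofReal_natCast, zero_add]
    refine ENNReal.ofReal_le_ofReal ((listSize_le_two_mul hN 1).trans ?_)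
    have := one_le_idealSize (k := k) hN 1
    nlinarith
  · rw [← ENNReal.ofReal_natCast, ← ENNReal.ofReal_mul (Nat.cast_nonneg _), Nat.add_sub_cancel]
    refine ENNReal.ofReal_le_ofReal (le_trans ?_ (listSize_mul_sqrt_le hk hN hi))
    gcongr
    refine groverPotential_zero_le ?_
    have hs : (0 : ℝ) < listSize k N i := by exact_mod_cast listSize_pos hN i
    rw [Real.one_le_sqrt, one_le_div hs]
    have h1 : (listSize k N i : ℝ) ≤ N := by exact_mod_cast listSize_le hN i
    nlinarith

lemma sum_failureWeight_le (hk : 1 ≤ k) (hN : 1 ≤ N) :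
    ∑ i ∈ Finset.Ioc 0 k, (listSize k N i : ℝ≥0∞) * failureWeight k N i ≤
      ENNReal.ofReal (k * (4 * (N : ℝ) ^ (-(1 : ℝ) / (2 : ℝ) ^ k))) := by
  refine sum_Ioc_le fun i hi => ?_
  have hs : (0 : ℝ) < listSize k N i := by exact_mod_cast listSize_pos hN i
  rw [failureWeight, Nat.add_sub_cancel, ← ENNReal.ofReal_natCast, ← ENNReal.ofReal_natCast,
    ← ENNReal.ofReal_div_of_pos hs, ← ENNReal.ofReal_mul (Nat.cast_nonneg _)]
  exact ENNReal.ofReal_le_ofReal (listSize_sq_div_le hk hN hi)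

end Weights

lemma QAlgorithm.prob_mono {X Y A : Type} [Fintype X] [Fintype Y] [AddCommGroup Y]
    (𝒜 : QAlgorithm X Y A) (F : X → Y) {P Q : A → ℕ → Prop}
    (h : ∀ a q, P a q → Q a q) : 𝒜.prob F P ≤ 𝒜.prob F Q :=
  iSup_mono fun n => (𝒜.dist F n).toOuterMeasure.mono fun _ ⟨a, ha, hP⟩ => ⟨a, ha, h a _ hP⟩

/-! ### Expected queries, correctness and success probability -/

section Bounds

variable {X Y : Type} [Fintype X] [Fintype Y] [AddCommGroup Y] [Nonempty X] {F : X → Y} {k : ℕ}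

lemma expect_queries_le (hk : 1 ≤ k) (hX : Fintype.card X = k * Fintype.card Y)
    (hF : ∀ y, (F ⁻¹' {y}).ncard = k) (hY : 1 ≤ Fintype.card Y) (n : ℕ) :
    expect ((collisionAlgorithm X Y k).dist F n) (fun s => (s.2 : ℝ≥0∞)) ≤
      ENNReal.ofReal (k * (72 * k * idealSize k (Fintype.card Y) 1)) := by
  refine le_trans (expect_mono _ fun s _ => ?_) ((expect_dist_potential_le hk hX hF hY
    (queryWeight k (Fintype.card Y)) 0 1 ?_ ?_ n).trans (sum_queryWeight_le hk hY))
  · rw [one_mul]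
    exact le_self_add
  · intro m r _
    simp [queryWeight]
  · intro i m r hi _ _ P hP0 hP1 hP
    have hi' : ¬ i ≤ 1 := by omega
    have h := groverPotential_nonneg √((k : ℝ) * Fintype.card Y /
      listSize k (Fintype.card Y) (i - 1)) (r + 1)
    rw [queryWeight, queryWeight, if_neg hi', if_neg hi', one_mul, zero_mul, mul_zero, add_zero,
      ← ENNReal.ofReal_mul (by linarith),
      ← ENNReal.ofReal_add (by positivity) (mul_nonneg (by linarith) h)]
    exact ENNReal.ofReal_le_ofReal (groverPotential_step hP0 hP le_rfl)

lemma expect_failure_le (hk : 1 ≤ k) (hX : Fintype.card X = k * Fintype.card Y)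
    (hF : ∀ y, (F ⁻¹' {y}).ncard = k) (hY : 1 ≤ Fintype.card Y) (n : ℕ) :
    expect ((collisionAlgorithm X Y k).dist F n) (fun s => potential F k
      (fun i _ => failureWeight k (Fintype.card Y) i) 1 s.1) ≤
      ENNReal.ofReal (k * (4 * (Fintype.card Y : ℝ) ^ (-(1 : ℝ) / (2 : ℝ) ^ k))) := by
  refine le_trans (expect_mono _ fun s _ => ?_) ((expect_dist_potential_le hk hX hF hY
    (fun i _ => failureWeight k (Fintype.card Y) i) 1 0 ?_ ?_ n).trans
      (sum_failureWeight_le hk hY))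
  · exact le_add_self
  · intro m r hm
    -- Because `t_0 = N`, the classical level fits the same formula `t_i / t_{i-1}`.
    rw [failureWeight, Nat.sub_self, listSize_zero hk, zero_add, one_mul]
    gcongr
  · intro i m r _ _ hm P hP0 hP1 _
    rw [zero_mul, zero_add, one_mul]
    -- Failure is possible only on success of a round, so a weight independent of `r` suffices,
    -- whatever `P` is.
    calc _ ≤ ENNReal.ofReal P * failureWeight k (Fintype.card Y) i +
          ENNReal.ofReal (1 - P) * failureWeight k (Fintype.card Y) i := by
          rw [failureWeight]
          gcongr
      _ = _ := by
          rw [← add_mul, ← ENNReal.ofReal_add hP0 (by linarith), add_sub_cancel,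
            ENNReal.ofReal_one, one_mul]

lemma potential_ne_top (hk : 1 ≤ k) (hX : Fintype.card X = k * Fintype.card Y)
    (hF : ∀ y, (F ⁻¹' {y}).ncard = k) (hY : 1 ≤ Fintype.card Y) (n : ℕ)
    {s : CollisionState X Y × ℕ} (hs : s ∈ ((collisionAlgorithm X Y k).dist F n).support) :
    potential F k (fun i _ => failureWeight k (Fintype.card Y) i) 1 s.1 ≠ ⊤ :=
  ne_top_of_expect_ne_top _
    (((expect_failure_le hk hX hF hY n).trans_lt ENNReal.ofReal_lt_top).ne) hs

/-- Whatever the algorithm outputs is a `k`-collision. -/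
lemma prob_not_isCollision (hk : 1 ≤ k) (hX : Fintype.card X = k * Fintype.card Y)
    (hF : ∀ y, (F ⁻¹' {y}).ncard = k) (hY : 1 ≤ Fintype.card Y) :
    (collisionAlgorithm X Y k).prob F
      (fun result _ => ∃ S, result = some S ∧ ¬ IsCollision F k S) = 0 := by
  rw [QAlgorithm.prob, ENNReal.iSup_eq_zero]
  intro n
  rw [PMF.toOuterMeasure_apply_eq_zero_iff, Set.disjoint_left]
  rintro ⟨s, q⟩ hs ⟨result, hact, S, rfl, hS⟩
  have hne := potential_ne_top hk hX hF hY n hs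
  cases s with
  | done result' =>
    rw [action_done] at hact
    cases hact
    exact hne (if_neg hS)
  | collect i L M r =>
    rcases Nat.lt_or_ge 1 i with hi | hi
    · rw [action_collect_of_two_le hi] at hact
      cases hact
    · by_cases hfr : (freshInputs M).Nonempty
      · rw [action_collect_of_le_one hi hfr] at hact
        cases hact
      -- Running out of fresh inputs halts with `none`, never with a set.
      · simp only [collisionAlgorithm, hi, hfr, if_true, dif_neg, not_false_eq_true] at hact
        cases hact

lemma not_halt_of_isCollecting (hX : Fintype.card X = k * Fintype.card Y)
    (hY : 1 ≤ Fintype.card Y) {i r : ℕ} {L M : CollisionList X Y} (h : IsCollecting F k i L M)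
    (result : Option (Finset X)) :
    (collisionAlgorithm X Y k).action (.collect i L M r) ≠ .halt result := by
  intro hact
  rcases Nat.lt_or_ge 1 i with hi | hi
  · rw [action_collect_of_two_le hi] at hact
    cases hact
  · rw [action_collect_of_le_one hi (freshInputs_nonempty hX hi h hY)] at hact
    cases hact

/-- A run of `n` steps outputs a `k`-collision after at most `b` queries, or fails, or makes at
least `n` queries, or makes more than `b` queries. -/
lemma one_le_prob_add (hk : 1 ≤ k) (hX : Fintype.card X = k * Fintype.card Y)
    (hF : ∀ y, (F ⁻¹' {y}).ncard = k) (hY : 1 ≤ Fintype.card Y) {b : ℝ} (hb : 0 < b) {n : ℕ}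
    (hn : 1 ≤ n) :
    1 ≤ (collisionAlgorithm X Y k).prob F (fun result q =>
        (∃ S, result = some S ∧ IsCollision F k S) ∧ (q : ℝ) ≤ b) +
      ENNReal.ofReal (k * (4 * (Fintype.card Y : ℝ) ^ (-(1 : ℝ) / (2 : ℝ) ^ k))) +
      ENNReal.ofReal (k * (72 * k * idealSize k (Fintype.card Y) 1) / b) +
      ENNReal.ofReal (k * (72 * k * idealSize k (Fintype.card Y) 1)) * (n : ℝ≥0∞)⁻¹ := by
  set A := {s : CollisionState X Y × ℕ | ∃ a, (collisionAlgorithm X Y k).action s.1 = .halt a ∧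
    (∃ S, a = some S ∧ IsCollision F k S) ∧ (s.2 : ℝ) ≤ b} with hA
  obtain ⟨p, hp⟩ : ∃ p : PMF (CollisionState X Y × ℕ), p = (collisionAlgorithm X Y k).dist F n :=
    ⟨_, rfl⟩
  -- A pointwise bound in which every reachable state is charged to one term; taking expectations
  -- yields the union bound and both uses of Markov's inequality at once.
  have key : ∀ s ∈ p.support,
      (1 : ℝ≥0∞) ≤ A.indicator (fun _ => 1) s +
        potential F k (fun i _ => failureWeight k (Fintype.card Y) i) 1 s.1 +
        (s.2 : ℝ≥0∞) * (ENNReal.ofReal b)⁻¹ + (s.2 : ℝ≥0∞) * (n : ℝ≥0∞)⁻¹ := by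
    rintro ⟨s, q⟩ hs
    have hne := potential_ne_top hk hX hF hY n (hp ▸ hs)
    have hhalt := QAlgorithm.halted_or_le_queries (collisionAlgorithm X Y k) F
      one_le_queries_of_action n (s, q) (hp ▸ hs)
    cases s with
    | done result =>
      cases result with
      | none =>
        rw [add_assoc, add_assoc]
        exact le_add_left le_self_add
      | some S =>
        by_cases hq : (q : ℝ) ≤ b
        · have hmem : ((.done (some S), q) : CollisionState X Y × ℕ) ∈ A := by
            refine ⟨some S, rfl, ⟨S, rfl, ?_⟩, hq⟩
            by_contra hS
            exact hne (if_neg hS)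
          rw [Set.indicator_of_mem hmem, add_assoc, add_assoc]
          exact le_self_add
        · refine le_add_right (le_add_left ?_)
          rw [← div_eq_mul_inv, ENNReal.le_div_iff_mul_le (.inl (by simpa using hb))
            (.inl ENNReal.ofReal_ne_top), one_mul, ← ENNReal.ofReal_natCast]
          exact ENNReal.ofReal_le_ofReal (not_le.1 hq).le
    | collect i L M r =>
      have hcol : IsCollecting F k i L M := by
        by_contra h
        exact hne (if_neg h)
      rcases hhalt with ⟨a, ha⟩ | hle
      · exact absurd ha (not_halt_of_isCollecting hX hY hcol a)
      · refine le_add_left ?_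
        rw [← div_eq_mul_inv, ENNReal.le_div_iff_mul_le
          (.inl (by exact_mod_cast Nat.one_le_iff_ne_zero.1 hn)) (.inl (by simp)), one_mul]
        exact_mod_cast hle
  have h := expect_mono p key
  rw [expect_const] at h
  simp only [expect_add, expect_mul_const] at h
  rw [expect_indicator] at h
  refine h.trans ?_
  have hA' : p.toOuterMeasure A ≤ (collisionAlgorithm X Y k).prob F (fun result q =>
      (∃ S, result = some S ∧ IsCollision F k S) ∧ (q : ℝ) ≤ b) := by
    rw [hp]
    exact le_iSup (fun n => ((collisionAlgorithm X Y k).dist F n).toOuterMeasure A) n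
  have hq : expect p (fun s => (s.2 : ℝ≥0∞)) ≤ _ := hp ▸ expect_queries_le hk hX hF hY n
  have hf : expect p (fun s => potential F k
    (fun i _ => failureWeight k (Fintype.card Y) i) 1 s.1) ≤ _ :=
      hp ▸ expect_failure_le hk hX hF hY n
  rw [ENNReal.ofReal_div_of_pos hb, div_eq_mul_inv (ENNReal.ofReal _)]
  gcongr

/-- Letting the number of steps tend to infinity removes the runs that have not halted. -/
lemma le_of_forall_le_add_mul_inv {x y φ : ℝ≥0∞} (hφ : φ ≠ ⊤)
    (h : ∀ n : ℕ, 1 ≤ n → y ≤ x + φ * (n : ℝ≥0∞)⁻¹) : y ≤ x := by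
  have h1 := (ENNReal.Tendsto.const_mul ENNReal.tendsto_inv_nat_nhds_zero (.inr hφ)).const_add x
  rw [mul_zero, add_zero] at h1
  exact ge_of_tendsto h1 (Filter.eventually_atTop.2 ⟨1, h⟩)

/-- The probability of finding a `k`-collision with at most `b` queries. -/
lemma one_le_prob_budget_add (hk : 1 ≤ k) (hX : Fintype.card X = k * Fintype.card Y)
    (hF : ∀ y, (F ⁻¹' {y}).ncard = k) (hY : 1 ≤ Fintype.card Y) {b : ℝ} (hb : 0 < b) :
    1 ≤ (collisionAlgorithm X Y k).prob F (fun result q =>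
        (∃ S, result = some S ∧ IsCollision F k S) ∧ (q : ℝ) ≤ b) +
      ENNReal.ofReal (k * (4 * (Fintype.card Y : ℝ) ^ (-(1 : ℝ) / (2 : ℝ) ^ k))) +
      ENNReal.ofReal (k * (72 * k * idealSize k (Fintype.card Y) 1) / b) :=
  le_of_forall_le_add_mul_inv ENNReal.ofReal_ne_top fun _ hn =>
    one_le_prob_add hk hX hF hY hb hn

/-- The probability of finding a `k`-collision. -/
lemma one_le_prob_isCollision_add (hk : 1 ≤ k) (hX : Fintype.card X = k * Fintype.card Y)
    (hF : ∀ y, (F ⁻¹' {y}).ncard = k) (hY : 1 ≤ Fintype.card Y) :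
    1 ≤ (collisionAlgorithm X Y k).prob F (fun result _ =>
        ∃ S, result = some S ∧ IsCollision F k S) +
      ENNReal.ofReal (k * (4 * (Fintype.card Y : ℝ) ^ (-(1 : ℝ) / (2 : ℝ) ^ k))) := by
  refine le_of_forall_le_add_mul_inv
    (φ := ENNReal.ofReal (k * (72 * k * idealSize k (Fintype.card Y) 1)))
    ENNReal.ofReal_ne_top fun n hn => ?_
  have hn' : (0 : ℝ) < n := by exact_mod_cast hn
  -- The budget is taken to be `n` itself, so that the Markov term vanishes in the limit.
  refine (one_le_prob_budget_add hk hX hF hY hn').trans ?_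
  rw [ENNReal.ofReal_div_of_pos hn', ENNReal.ofReal_natCast, ← div_eq_mul_inv]
  gcongr
  exact QAlgorithm.prob_mono _ F fun _ _ h => h.1

end Bounds

end QuantumCollision

end

theorem mainTheorem3 (k : ℕ) (hk : 1 ≤ k) :
    ∃ C : ℝ, 0 < C ∧
      ∀ (X Y : Type) [Fintype X] [Fintype Y] [AddCommGroup Y] [Nonempty X] (N : ℕ) (F : X → Y),
        Fintype.card Y = N → Fintype.card X = k * N → (∀ y : Y, (F ⁻¹' {y}).ncard = k) →
        -- the total of the `t_{i+1} √(N / t_i)`, and the expected number of queries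
        (∑ i ∈ Finset.range k, QuantumCollision.idealSize k N (i + 1) *
            √((N : ℝ) / QuantumCollision.idealSize k N i)
          = k * (N : ℝ) ^ (((2 : ℝ) ^ (k - 1) - 1) / ((2 : ℝ) ^ k - 1))) ∧
        (QuantumCollision.collisionAlgorithm X Y k).expectedQueries F
          ≤ ENNReal.ofReal (C * (N : ℝ) ^ (((2 : ℝ) ^ (k - 1) - 1) / ((2 : ℝ) ^ k - 1))) ∧
        -- whatever the algorithm outputs is a `k`-collision
        (QuantumCollision.collisionAlgorithm X Y k).prob F
          (fun result _ => ∃ S, result = some S ∧ ¬ QuantumCollision.IsCollision F k S) = 0 ∧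
        -- the probability of finding a `k`-collision
        ENNReal.ofReal (1 - C * (N : ℝ) ^ (-(1 : ℝ) / (2 : ℝ) ^ k))
          ≤ (QuantumCollision.collisionAlgorithm X Y k).prob F
              (fun result _ => ∃ S, result = some S ∧ QuantumCollision.IsCollision F k S) ∧
        -- the same within a fixed budget of queries
        ∀ B : ℝ, 0 < B →
          ENNReal.ofReal (1 - C * (N : ℝ) ^ (-(1 : ℝ) / (2 : ℝ) ^ k) - C / B)
            ≤ (QuantumCollision.collisionAlgorithm X Y k).prob F
                (fun result q => (∃ S, result = some S ∧ QuantumCollision.IsCollision F k S) ∧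
                  (q : ℝ) ≤ B * (N : ℝ) ^ (((2 : ℝ) ^ (k - 1) - 1) / ((2 : ℝ) ^ k - 1))) := by
  have hk' : (1 : ℝ) ≤ k := by exact_mod_cast hk
  -- The constant of the query bound also dominates the failure constant `4k`, since `k ≥ 1`.
  refine ⟨k * (72 * k), by positivity, ?_⟩
  intro X Y _ _ _ _ N F hYN hX hF
  subst hYN
  have hY : 1 ≤ Fintype.card Y := Fintype.card_pos_iff.2 ⟨0⟩
  have hE : (Fintype.card Y : ℝ) ^ (((2 : ℝ) ^ (k - 1) - 1) / ((2 : ℝ) ^ k - 1)) =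
      QuantumCollision.idealSize k (Fintype.card Y) 1 := rfl
  have hE1 := QuantumCollision.one_le_idealSize (k := k) hY 1
  rw [hE]
  set E := QuantumCollision.idealSize k (Fintype.card Y) 1
  set D := (Fintype.card Y : ℝ) ^ (-(1 : ℝ) / (2 : ℝ) ^ k) with hD
  have hD0 : 0 ≤ D := by positivity
  have hψ : k * (4 * D) ≤ k * (72 * k) * D := by
    rw [mul_assoc (k : ℝ)]
    gcongr
    linarith
  have hC0 : (0 : ℝ) ≤ k * (72 * k) * D := by positivity
  refine ⟨?_, ?_, QuantumCollision.prob_not_isCollision hk hX hF hY, ?_, ?_⟩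
  · rw [Finset.sum_congr rfl fun i hi => QuantumCollision.idealSize_succ_mul_sqrt hk hY
      (Finset.mem_range.1 hi), Finset.sum_const, Finset.card_range, nsmul_eq_mul]
  · refine iSup_le fun n => ?_
    rw [mul_assoc]
    exact QuantumCollision.expect_queries_le hk hX hF hY n
  · rw [ENNReal.ofReal_sub _ hC0, ENNReal.ofReal_one, tsub_le_iff_right]
    exact (QuantumCollision.one_le_prob_isCollision_add hk hX hF hY).trans
      (add_le_add_right (ENNReal.ofReal_le_ofReal hψ) _)
  · intro B hB
    have hBE : 0 < B * E := by positivity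
    have h := QuantumCollision.one_le_prob_budget_add hk hX hF hY hBE
    -- With budget `B * E`, the factor `E` cancels and the Markov term is exactly `C / B`.
    rw [show (k : ℝ) * (72 * k * QuantumCollision.idealSize k (Fintype.card Y) 1) / (B * E) =
      k * (72 * k) / B by
        change (k : ℝ) * (72 * k * E) / (B * E) = _
        field_simp] at h
    rw [ENNReal.ofReal_sub _ (by positivity), ENNReal.ofReal_sub _ hC0, ENNReal.ofReal_one,
      tsub_le_iff_right, tsub_le_iff_right]
    refine h.trans ?_
    rw [add_right_comm]
    exact add_le_add_right (ENNReal.ofReal_le_ofReal hψ) _
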